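/- Let $\mathbb X\subset\mathbb R^n$ be Lebesgue measurable and let $(X_t)$ be a Markov process on $\mathbb X$ with transition densities $p^t:\mathbb X\times\mathbb X\to[0,\infty)$, $t>0$, having a unique stationary probability measure $\mu$; $\mu$ has a continuous, strictly positive Lebesgue density $\pi$ and detailed balance $p^t(x,y)\pi(x)=p^t(y,x)\pi(y)$ holds. Let $0\le r\le n$, let $\mathbb Z\subset\mathbb R^r$ be a domain (any Borel set is allowed) and let $\xi:\mathbb X\to\mathbb Z$ be a reaction coordinate which is $C^1$ on a neighbourhood of $\mathbb X$ and whose gradient $\nabla\xi\in\mathbb R^{n\times r}$ has full rank at almost every point of $\mathbb X$. On the level set $\Sigma_\xi(z)=\{x\in\mathbb X:\xi(x)=z\}$ let $$d\mu_z(x)=\pi(x)\,\det\big(\nabla\xi(x)^{\top}\nabla\xi(x)\big)^{-1/2}\,dH_{n-r}(x),$$ where $H_{n-r}$ is the $(n-r)$-dimensional Hausdorff measure (points where the determinant vanishes get weight $0$). Let $\lambda$ be Lebesgue measure on $\mathbb X$, $|\mathbb Z|$ the Lebesgue measure of $\mathbb Z$, $\tau>0$ a lag time and $\varepsilon\ge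 0$. For a function $q:\mathbb Z\times\mathbb X\to[0,\infty)$, with $(x,y)\mapsto q(\xi(x),y)$ measurable with respect to $\mu\times\lambda$, condition $(\mathrm L)$ at time $t$ is $$\frac1{|\mathbb Z|}\int_{\mathbb X}\int_{\mathbb X}\big|p^t(x,y)-q(\xi(x),y)\big|\,dy\,d\mu(x)\le\varepsilon .$$ The system is $\varepsilon$-lumpable with respect to $\xi$ if there are functions $p_L^t$ such that $(\mathrm L)$ holds with $q=p_L^t$ for all $t\ge\tau$. It is differentially $\varepsilon$-lumpable with respect to $\xi$ if $$\frac1{|\mathbb Z|}\int_{\mathbb Z}\int_{\Sigma_\xi(z)}\int_{\Sigma_\xi(z)}\big\|p^\tau(x^{(1)},\cdot)-p^\tau(x^{(2)},\cdot)\big\|_{L^1}\,d\mu_z(x^{(1)})\,d\mu_z(x^{(2)})\,dz\le\varepsilon .\tag{L$'$}$$ **Lemma.** (a) Suppose that $\mu_z$ is a probability measure for almost every $z\in\mathbb Z$. If the system is $\varepsilon$-lumpable with respect to $\xi$ (it suffices that $(\mathrm L)$ holds at $t=\tau$ for some $q$), then it is differentially $2\varepsilon$-lumpable with respect to $\xi$.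 Conversely, if it is differentially $\varepsilon$-lumpable with respect to $\xi$, then it is $\varepsilon$-lumpable with respect to $\xi$, with $$p_L^t(z,\cdot)=\int_{\Sigma_\xi(z)}p^t(x',\cdot)\,d\mu_z(x')\qquad(t\ge\tau).$$ (b) Without the supposition on $\mu_z$, both implications hold if in $(\mathrm L')$ the inner integral over $x^{(1)}$ and in $p_L^t$ the integral over $x'$ are replaced by averages, that is, by integrals with respect to the normalized measure $\mu_z/\mu_z(\Sigma_\xi(z))$. -/

import Mathlib

open MeasureTheory ProbabilityTheory
open scoped ENNReal Matrix

namespace ReactionCoordinate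

noncomputable section

/-- Lebesgue measure on a Lebesgue-measurable set `X ⊆ ℝⁿ`. -/
def leb {n : ℕ} (X : Set (EuclideanSpace ℝ (Fin n))) : Measure X :=
  Measure.comap Subtype.val volume

/-- The measure `dμ = π(x) dx` on `X`. -/
def densityMeasure {n : ℕ} {X : Set (EuclideanSpace ℝ (Fin n))} (dens : X → ℝ) : Measure X :=
  (leb X).withDensity fun x => ENNReal.ofReal (dens x)

/-- A time- and space-continuous Markov process on `X ⊆ ℝⁿ`, given by its transition
probability functions `P t` for `t > 0`. They have transition densities `p t`; the process has a
unique stationary probability measure, this measure has a continuous and strictly positive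
density `dens` (written `π` in the text), and detailed balance holds. -/
structure MarkovSystem {n : ℕ} (X : Set (EuclideanSpace ℝ (Fin n))) where
  P : ℝ → Kernel X X
  markov : ∀ t, 0 < t → IsMarkovKernel (P t)
  chapman_kolmogorov : ∀ s t, 0 < s → 0 < t → P (s + t) = P t ∘ₖ P s
  p : ℝ → X → X → ℝ
  p_measurable : ∀ t, 0 < t → Measurable fun w : X × X => p t w.1 w.2
  p_nonneg : ∀ t, 0 < t → ∀ x y, 0 ≤ p t x y
  p_density : ∀ t, 0 < t → ∀ x,
    P t x = (leb X).withDensity fun y => ENNReal.ofReal (p t x y)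
  dens : X → ℝ
  dens_continuous : Continuous dens
  dens_pos : ∀ x, 0 < dens x
  prob : IsProbabilityMeasure (densityMeasure dens)
  stationary : ∀ t, 0 < t → (P t).Invariant (densityMeasure dens)
  stationary_unique : ∀ ν : Measure X, IsProbabilityMeasure ν →
    (∀ t, 0 < t → (P t).Invariant ν) → ν = densityMeasure dens
  detailed_balance : ∀ t, 0 < t → ∀ x y, p t x y * dens x = p t y x * dens y

/-- The stationary measure `μ`. -/
def MarkovSystem.mu {n : ℕ} {X : Set (EuclideanSpace ℝ (Fin n))} (S : MarkovSystem X) :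
    Measure X :=
  densityMeasure S.dens

/-- The matrix `∇ξ(x) ∈ ℝ^{n × r}`, whose columns are the gradients of the components of `ξ`. -/
def grad {n r : ℕ} (ξ : EuclideanSpace ℝ (Fin n) → EuclideanSpace ℝ (Fin r))
    (x : EuclideanSpace ℝ (Fin n)) : Matrix (Fin n) (Fin r) ℝ :=
  Matrix.of fun i j => (fderiv ℝ ξ x (EuclideanSpace.single i 1)) j

/-- `det (∇ξ(x)ᵀ ∇ξ(x))`. -/
def gramDet {n r : ℕ} (ξ : EuclideanSpace ℝ (Fin n) → EuclideanSpace ℝ (Fin r))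
    (x : EuclideanSpace ℝ (Fin n)) : ℝ :=
  ((grad ξ x)ᵀ * grad ξ x).det

/-- `ξ : X → Z` is a reaction coordinate for which `∇ξ` and the factor
`det (∇ξᵀ ∇ξ) ^ (-1/2)` make sense: `ξ` is continuously differentiable near `X`, and
`∇ξ` has full rank at almost every point of `X`. -/
structure IsReactionCoordinate {n r : ℕ} (X : Set (EuclideanSpace ℝ (Fin n)))
    (Z : Set (EuclideanSpace ℝ (Fin r)))
    (ξ : EuclideanSpace ℝ (Fin n) → EuclideanSpace ℝ (Fin r)) : Prop where
  mapsTo : Set.MapsTo ξ X Z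
  contDiffOn : ∃ U, IsOpen U ∧ X ⊆ U ∧ ContDiffOn ℝ 1 ξ U
  nondegenerate : ∀ᵐ x : X ∂leb X, gramDet ξ x ≠ 0

/-- The level set `Σ_ξ(z)`. -/
def levelSet {n r : ℕ} (X : Set (EuclideanSpace ℝ (Fin n)))
    (ξ : EuclideanSpace ℝ (Fin n) → EuclideanSpace ℝ (Fin r))
    (z : EuclideanSpace ℝ (Fin r)) : Set X :=
  {x | ξ x = z}

variable {n r : ℕ} {X : Set (EuclideanSpace ℝ (Fin n))}

/-- The marginal stationary measure `μ_z` on the level set `Σ_ξ(z)`, that is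
`π(x) det (∇ξ(x)ᵀ ∇ξ(x)) ^ (-1/2) dH_{n-r}(x)`, where `H_{n-r}` is the Hausdorff measure
(normalized to be Lebesgue measure on `ℝ^{n-r}`). Points where the determinant vanishes get
weight zero. -/
def MarkovSystem.levelMeasure (S : MarkovSystem X)
    (ξ : EuclideanSpace ℝ (Fin n) → EuclideanSpace ℝ (Fin r))
    (z : EuclideanSpace ℝ (Fin r)) : Measure X :=
  ((Measure.euclideanHausdorffMeasure (n - r) : Measure X).restrict
      (levelSet X ξ z)).withDensity
    fun x => ENNReal.ofReal (S.dens x * (Real.sqrt (gramDet ξ x))⁻¹)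

/-- `‖p^t(x₁, ·) - p^t(x₂, ·)‖` in `L¹(X)`. -/
def MarkovSystem.dist (S : MarkovSystem X) (t : ℝ) (x₁ x₂ : X) : ℝ≥0∞ :=
  eLpNorm (fun y => S.p t x₁ y - S.p t x₂ y) 1 (leb X)

/-- Condition (L) at time `t` with the effective density `q : Z × X → ℝ⁺`:
`|Z|⁻¹ ‖p^t(∗, ·) - q(ξ(∗), ·)‖_𝕂 ≤ ε`, where `𝕂 = L¹(μ × λ)`. -/
def MarkovSystem.IsLumpableWith (S : MarkovSystem X) (Z : Set (EuclideanSpace ℝ (Fin r)))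
    (ξ : EuclideanSpace ℝ (Fin n) → EuclideanSpace ℝ (Fin r)) (t ε : ℝ)
    (q : EuclideanSpace ℝ (Fin r) → X → ℝ) : Prop :=
  (∀ z ∈ Z, ∀ y, 0 ≤ q z y) ∧
  AEStronglyMeasurable (fun w : X × X => q (ξ w.1) w.2) (S.mu.prod (leb X)) ∧
  (volume Z)⁻¹ *
    eLpNorm (fun w : X × X => S.p t w.1 w.2 - q (ξ w.1) w.2) 1 (S.mu.prod (leb X))
      ≤ ENNReal.ofReal ε

/-- Condition (L) at the single time `t`, for some effective density. -/
def MarkovSystem.IsLumpableAt (S : MarkovSystem X) (Z : Set (EuclideanSpace ℝ (Fin r)))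
    (ξ : EuclideanSpace ℝ (Fin n) → EuclideanSpace ℝ (Fin r)) (t ε : ℝ) : Prop :=
  ∃ q, S.IsLumpableWith Z ξ t ε q

/-- `ε`-lumpability with lag time `τ` through the family `q t` of effective densities:
condition (L) holds for all `t ≥ τ`. -/
def MarkovSystem.IsLumpableThrough (S : MarkovSystem X) (Z : Set (EuclideanSpace ℝ (Fin r)))
    (ξ : EuclideanSpace ℝ (Fin n) → EuclideanSpace ℝ (Fin r)) (τ ε : ℝ)
    (q : ℝ → EuclideanSpace ℝ (Fin r) → X → ℝ) : Prop :=
  ∀ t, τ ≤ t → S.IsLumpableWith Z ξ t ε (q t)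

/-- `ε`-lumpability with respect to `ξ`, with lag time `τ`. -/
def MarkovSystem.IsLumpable (S : MarkovSystem X) (Z : Set (EuclideanSpace ℝ (Fin r)))
    (ξ : EuclideanSpace ℝ (Fin n) → EuclideanSpace ℝ (Fin r)) (τ ε : ℝ) : Prop :=
  ∃ q, S.IsLumpableThrough Z ξ τ ε q

theorem MarkovSystem.IsLumpable.isLumpableAt {S : MarkovSystem X}
    {Z : Set (EuclideanSpace ℝ (Fin r))}
    {ξ : EuclideanSpace ℝ (Fin n) → EuclideanSpace ℝ (Fin r)} {τ ε : ℝ}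
    (h : S.IsLumpable Z ξ τ ε) : S.IsLumpableAt Z ξ τ ε :=
  h.elim fun q hq => ⟨q τ, hq τ le_rfl⟩

/-- Differential `ε`-lumpability with respect to `ξ`, with lag time `τ`:
`|Z|⁻¹ ∫_Z ∫ ∫ ‖p^τ(x₁, ·) - p^τ(x₂, ·)‖_{L¹} dμ_z(x₁) dμ_z(x₂) dz ≤ ε`. -/
def MarkovSystem.IsDifferentiallyLumpable (S : MarkovSystem X)
    (Z : Set (EuclideanSpace ℝ (Fin r)))
    (ξ : EuclideanSpace ℝ (Fin n) → EuclideanSpace ℝ (Fin r)) (τ ε : ℝ) : Prop :=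
  (volume Z)⁻¹ *
    ∫⁻ z in Z, ∫⁻ x₂, ∫⁻ x₁, S.dist τ x₁ x₂ ∂(S.levelMeasure ξ z) ∂(S.levelMeasure ξ z)
      ≤ ENNReal.ofReal ε

/-- The form of differential `ε`-lumpability for marginal measures `μ_z` of arbitrary total
mass: the inner integral is the average over the level set, that is the integral with respect to
the probability measure `μ_z / μ_z(Σ_ξ(z))`. -/
def MarkovSystem.IsDifferentiallyLumpableAvg (S : MarkovSystem X)
    (Z : Set (EuclideanSpace ℝ (Fin r)))
    (ξ : EuclideanSpace ℝ (Fin n) → EuclideanSpace ℝ (Fin r)) (τ ε : ℝ) : Prop :=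
  (volume Z)⁻¹ *
    ∫⁻ z in Z, ∫⁻ x₂, ⨍⁻ x₁, S.dist τ x₁ x₂ ∂(S.levelMeasure ξ z) ∂(S.levelMeasure ξ z)
      ≤ ENNReal.ofReal ε

end

end ReactionCoordinate

/-!
By the coarea formula, the measures `μ_z` disintegrate `μ = ∫ μ_z dz` along `ξ`. On the fibre
over `z` the effective density `q(z, ·)` is constant, so the triangle inequality through it bounds
`‖p^τ(x₁, ·) - p^τ(x₂, ·)‖_{L¹}` by the errors at `x₁` and `x₂`, whence the factor `2`. Conversely,
the distance from `p^t(x, ·)` to the average of `p^t(x', ·)` over the fibre through `x` is at most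
the average of the distances, and passing from `τ` to `t ≥ τ` decreases these distances because a
Markov kernel contracts the `L¹` norm.

For `C¹` maps the coarea formula follows from Fubini's theorem for surjective linear maps: near a
regular point, a bi-Lipschitz map with constant as close to `1` as we like carries the fibres of
`ξ` into those of its derivative, and `d`-dimensional Hausdorff measure changes by at most the
`d`-th power of that constant.
-/

namespace ReactionCoordinate

open Filter Function Measure Module Set Topology
open scoped NNReal

theorem finrank_sub_finrank_eq_finrank_ker {K E F : Type*} [DivisionRing K]
    [AddCommGroup E] [Module K E] [FiniteDimensional K E] [AddCommGroup F] [Module K F]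
    {L : E →ₗ[K] F} (hL : Surjective L) :
    finrank K E - finrank K F = finrank K L.ker := by
  have := L.finrank_range_add_finrank_ker
  rw [LinearMap.range_eq_top.2 hL, finrank_top] at this
  lia

section Kernel

variable {E F : Type*} [NormedAddCommGroup E] [InnerProductSpace ℝ E] [FiniteDimensional ℝ E]
  [AddCommGroup F] [Module ℝ F]

theorem bijective_domRestrict_orthogonal_ker {L : E →ₗ[ℝ] F} (hL : Surjective L) :
    Bijective (L.domRestrict L.kerᗮ) := by
  refine ⟨LinearMap.ker_eq_bot.1 (LinearMap.ker_eq_bot'.2 ?_), fun z => ?_⟩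
  · rintro ⟨w, hw⟩ h
    have hw' : w ∈ L.ker := h
    simpa using Submodule.inner_right_of_mem_orthogonal hw' hw
  · obtain ⟨x, rfl⟩ := hL z
    obtain ⟨u, hu, w, hw, rfl⟩ := L.ker.exists_add_mem_mem_orthogonal x
    exact ⟨⟨w, hw⟩, by simp [LinearMap.mem_ker.1 hu]⟩

variable [MeasurableSpace E] [BorelSpace E]

theorem euclideanHausdorffMeasure_inter_fiber (L : E →ₗ[ℝ] F) (C : Set E) (w : E) :
    (μHE[finrank ℝ L.ker] : Measure E) (C ∩ L ⁻¹' {L w}) =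
      volume {u : L.ker | (u : E) + w ∈ C} := by
  have hiso : Isometry fun u : L.ker => (u : E) + w :=
    Isometry.of_dist_eq fun a b => by simp [Subtype.dist_eq]
  have hrange : range (fun u : L.ker => (u : E) + w) = L ⁻¹' {L w} := by
    ext x
    refine ⟨?_, fun h => ⟨⟨x - w, ?_⟩, by simp⟩⟩
    · rintro ⟨u, rfl⟩
      simp
    · rw [LinearMap.mem_ker, map_sub, sub_eq_zero]
      exact h
  rw [← InnerProductSpace.euclideanHausdorffMeasure_eq_volume, ← hrange,
    ← hiso.euclideanHausdorffMeasure_preimage]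
  rfl

theorem lintegral_orthogonal_ker_fiber (L : E →ₗ[ℝ] F) {C : Set E} (hC : MeasurableSet C) :
    ∫⁻ w : L.kerᗮ, (μHE[finrank ℝ L.ker] : Measure E) (C ∩ L ⁻¹' {L w}) = volume C := by
  have hC' : MeasurableSet ((L.ker.measurableEquivProd (0 : E)).symm ⁻¹' C) :=
    (L.ker.measurableEquivProd (0 : E)).symm.measurable hC
  rw [← InnerProductSpace.euclideanHausdorffMeasure_eq_volume (V := E),
    ← (L.ker.measurePreserving_measurableEquivProd (0 : E)).symm.measure_preimage_equiv,
    Measure.volume_eq_prod, Measure.prod_apply_symm hC']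
  simp_rw [euclideanHausdorffMeasure_inter_fiber]
  refine lintegral_congr fun w => congrArg _ ?_
  ext u
  simp

end Kernel

section CoareaFactor

variable {E F : Type*} [NormedAddCommGroup E] [InnerProductSpace ℝ E] [FiniteDimensional ℝ E]
  [NormedAddCommGroup F] [InnerProductSpace ℝ F] [FiniteDimensional ℝ F]

/-- The coarea factor `√det (L Lᵀ)` of a linear map `L`, that is the volume distortion of its
adjoint. It is nonzero exactly when `L` is surjective. -/
noncomputable def coareaFactor (L : E →ₗ[ℝ] F) : ℝ :=
  L.adjoint.normDet

theorem coareaFactor_nonneg (L : E →ₗ[ℝ] F) : 0 ≤ coareaFactor L :=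
  LinearMap.normDet_nonneg _

theorem coareaFactor_eq_sqrt_det (L : E →ₗ[ℝ] F) :
    coareaFactor L = √(L ∘ₗ L.adjoint).det := by
  have h := L.adjoint.normDet_sq
  simp only [RCLike.ofReal_real_eq_id, id_eq, LinearMap.adjoint_adjoint] at h
  rw [← h, Real.sqrt_sq (LinearMap.normDet_nonneg _), coareaFactor]

theorem continuous_coareaFactor : Continuous fun L : E →L[ℝ] F => coareaFactor (L : E →ₗ[ℝ] F) := by
  have h : ∀ L : E →L[ℝ] F,
      coareaFactor (L : E →ₗ[ℝ] F) = √(L ∘L ContinuousLinearMap.adjoint L).det :=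
    fun L => coareaFactor_eq_sqrt_det _
  simp_rw [h]
  exact (ContinuousLinearMap.continuous_det.comp
    (continuous_id.clm_comp ContinuousLinearMap.adjoint.continuous)).sqrt

theorem surjective_of_coareaFactor_ne_zero {L : E →ₗ[ℝ] F} (h : coareaFactor L ≠ 0) :
    Surjective L := by
  have hker : L.adjoint.ker = ⊥ := ((LinearMap.normDet_ne_zero_tfae _).out 0 1).1 h
  have hrange := LinearMap.orthogonal_ker L.adjoint
  rw [hker, Submodule.bot_orthogonal_eq_top, LinearMap.adjoint_adjoint] at hrange
  exact LinearMap.range_eq_top.1 hrange.symm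

theorem normDet_adjoint_equiv (M : E ≃ₗ[ℝ] F) :
    (M : E →ₗ[ℝ] F).adjoint.normDet = (M : E →ₗ[ℝ] F).normDet := by
  rw [← sq_eq_sq₀ (LinearMap.normDet_nonneg _) (LinearMap.normDet_nonneg _)]
  have hadj := (M : E →ₗ[ℝ] F).adjoint.normDet_sq
  have hM := (M : E →ₗ[ℝ] F).normDet_sq
  simp only [RCLike.ofReal_real_eq_id, id_eq, LinearMap.adjoint_adjoint] at hadj hM
  rw [hadj, hM, ← LinearMap.det_conj _ M]
  congr 1
  ext x
  simp

theorem coareaFactor_eq_normDet_domRestrict {L : E →ₗ[ℝ] F} (hL : Surjective L) :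
    coareaFactor L = (L.domRestrict L.kerᗮ).normDet := by
  let M : L.kerᗮ ≃ₗ[ℝ] F := .ofBijective _ (bijective_domRestrict_orthogonal_ker hL)
  have hmem : ∀ z, L.adjoint z ∈ L.kerᗮ := fun z =>
    (Submodule.mem_orthogonal _ _).2 fun u hu => by
      rw [LinearMap.adjoint_inner_right, LinearMap.mem_ker.1 hu, inner_zero_left]
  have hadj : L.adjoint.codRestrict _ hmem = (M : L.kerᗮ →ₗ[ℝ] F).adjoint := by
    refine LinearMap.ext fun z => ext_inner_left ℝ fun w => ?_
    rw [LinearMap.adjoint_inner_right, Submodule.coe_inner]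
    exact LinearMap.adjoint_inner_right ..
  rw [coareaFactor, ← LinearMap.normDet_codRestrict hmem, hadj, normDet_adjoint_equiv]
  rfl

variable [MeasurableSpace E] [BorelSpace E] [MeasurableSpace F] [BorelSpace F]

theorem measurable_measure_inter_fiber {L : E →ₗ[ℝ] F} (hL : Surjective L) {C : Set E}
    (hC : MeasurableSet C) :
    Measurable fun z => (μHE[finrank ℝ L.ker] : Measure E) (C ∩ L ⁻¹' {z}) := by
  let M : L.kerᗮ ≃L[ℝ] F :=
    (LinearEquiv.ofBijective _ (bijective_domRestrict_orthogonal_ker hL)).toContinuousLinearEquiv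
  have hfib : ∀ z, (μHE[finrank ℝ L.ker] : Measure E) (C ∩ L ⁻¹' {z}) =
      volume {u : L.ker | (u : E) + M.symm z ∈ C} := fun z => by
    rw [← euclideanHausdorffMeasure_inter_fiber, show L (M.symm z) = z from M.apply_symm_apply z]
  simp_rw [hfib]
  have hC' : MeasurableSet {p : L.ker × F | (p.1 : E) + M.symm p.2 ∈ C} :=
    (by fun_prop : Continuous fun p : L.ker × F => (p.1 : E) + M.symm p.2).measurable hC
  exact measurable_measure_prodMk_right hC'

theorem volume_eq_coareaFactor_smul_map {L : E →ₗ[ℝ] F} (hL : Surjective L) :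
    (volume : Measure F) =
      ENNReal.ofReal (coareaFactor L) • (volume : Measure L.kerᗮ).map (L.domRestrict L.kerᗮ) := by
  have hbij := bijective_domRestrict_orthogonal_ker hL
  have hrank : finrank ℝ L.kerᗮ = finrank ℝ F := (LinearEquiv.ofBijective _ hbij).finrank_eq
  ext s hs
  rw [Measure.smul_apply, smul_eq_mul, coareaFactor_eq_normDet_domRestrict hL,
    Measure.map_apply (LinearMap.continuous_of_finiteDimensional _).measurable hs,
    ← LinearMap.euclideanHausdorffMeasure_image_eq_normDet_mul_volume, hrank,
    InnerProductSpace.euclideanHausdorffMeasure_eq_volume, image_preimage_eq s hbij.2]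

theorem lintegral_measure_inter_fiber {L : E →ₗ[ℝ] F} (hL : Surjective L) {C : Set E}
    (hC : MeasurableSet C) :
    ∫⁻ z, (μHE[finrank ℝ L.ker] : Measure E) (C ∩ L ⁻¹' {z}) =
      ENNReal.ofReal (coareaFactor L) * volume C := by
  rw [volume_eq_coareaFactor_smul_map hL, lintegral_smul_measure,
    lintegral_map (measurable_measure_inter_fiber hL hC)
      (LinearMap.continuous_of_finiteDimensional _).measurable, smul_eq_mul]
  congr 1
  exact lintegral_orthogonal_ker_fiber L hC

end CoareaFactor

section AlmostEq

/-- `a` and `b` agree up to a factor `c`. -/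
def AlmostEq (c : ℝ≥0) (a b : ℝ≥0∞) : Prop :=
  a ≤ c * b ∧ b ≤ c * a

namespace AlmostEq

variable {c c' : ℝ≥0} {a b d : ℝ≥0∞}

theorem mono (h : AlmostEq c a b) (hc : c ≤ c') : AlmostEq c' a b :=
  ⟨h.1.trans (by gcongr), h.2.trans (by gcongr)⟩

theorem trans (hab : AlmostEq c a b) (hbd : AlmostEq c' b d) : AlmostEq (c * c') a d := by
  refine ⟨hab.1.trans ?_, hbd.2.trans ?_⟩
  · grw [hbd.1, ENNReal.coe_mul, mul_assoc]
  · grw [hab.2, ENNReal.coe_mul, mul_left_comm, mul_assoc]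

theorem const_mul (h : AlmostEq c a b) : AlmostEq c (d * a) (d * b) :=
  ⟨by grw [h.1, mul_left_comm], by grw [h.2, mul_left_comm]⟩

theorem tsum {a b : ℕ → ℝ≥0∞} (h : ∀ i, AlmostEq c (a i) (b i)) :
    AlmostEq c (∑' i, a i) (∑' i, b i) :=
  ⟨ENNReal.tsum_mul_left ▸ ENNReal.tsum_le_tsum fun i => (h i).1,
    ENNReal.tsum_mul_left ▸ ENNReal.tsum_le_tsum fun i => (h i).2⟩

theorem lintegral {α : Type*} [MeasurableSpace α] {μ : Measure α} {f g : α → ℝ≥0∞}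
    (h : ∀ᵐ x ∂μ, AlmostEq c (f x) (g x)) : AlmostEq c (∫⁻ x, f x ∂μ) (∫⁻ x, g x ∂μ) := by
  constructor <;> rw [← lintegral_const_mul' _ _ ENNReal.coe_ne_top] <;>
    refine lintegral_mono_ae (h.mono fun x hx => ?_)
  exacts [hx.1, hx.2]

theorem tendsto {c : ℕ → ℝ≥0} {b : ℕ → ℝ≥0∞} (hc : Tendsto c atTop (𝓝 1))
    (h : ∀ i, AlmostEq (c i) a (b i)) : Tendsto b atTop (𝓝 a) := by
  have hcE : Tendsto (fun i => (c i : ℝ≥0∞)) atTop (𝓝 1) := by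
    simpa using ENNReal.tendsto_coe.2 hc
  have hdiv : Tendsto (fun i => a / c i) atTop (𝓝 a) := by
    simpa using ENNReal.Tendsto.const_div hcE (Or.inl ENNReal.one_ne_top) (a := a)
  have hmul : Tendsto (fun i => c i * a) atTop (𝓝 a) := by
    simpa using ENNReal.Tendsto.mul_const hcE (Or.inl one_ne_zero) (b := a)
  exact tendsto_of_tendsto_of_tendsto_of_le_of_le hdiv hmul
    (fun i => ENNReal.div_le_of_le_mul' (h i).1) fun i => (h i).2

end AlmostEq

end AlmostEq

section BiLipschitz

theorem biLipschitz_id_add {E : Type*} [SeminormedAddCommGroup E] {g : E → E} {B : Set E}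
    {c : ℝ≥0} (hc : 1 ≤ c) (hg : LipschitzOnWith (1 - c⁻¹) g B) :
    LipschitzOnWith c (fun x => x + g x) B ∧
      AntilipschitzWith c (B.domRestrict fun x => x + g x) := by
  have hc₀ : 0 < c := zero_lt_one.trans_le hc
  constructor
  · refine (LipschitzWith.id.lipschitzOnWith.add hg).weaken ?_
    rw [← add_tsub_assoc_of_le (inv_le_one_of_one_le₀ hc), tsub_le_iff_right]
    have hsq : 0 ≤ (c - 1 : ℝ) ^ 2 * (c : ℝ)⁻¹ := by positivity
    have : (1 + 1 : ℝ) ≤ c + (c : ℝ)⁻¹ := by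
      have : (c : ℝ) * (c : ℝ)⁻¹ = 1 := mul_inv_cancel₀ (by exact_mod_cast hc₀.ne')
      nlinarith
    exact_mod_cast this
  · have hlt : 1 - c⁻¹ < (1 : ℝ≥0)⁻¹ := by
      rw [inv_one]
      exact tsub_lt_self one_pos (inv_pos.2 hc₀)
    have h := (isometry_subtype_coe (s := B)).antilipschitz.add_lipschitzWith hg.to_restrict hlt
    rwa [inv_one, tsub_tsub_cancel_of_le (inv_le_one_of_one_le₀ hc), inv_inv] at h

theorem almostEq_euclideanHausdorffMeasure_image {M N : Type*} [EMetricSpace M]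
    [MeasurableSpace M] [BorelSpace M] [EMetricSpace N] [MeasurableSpace N] [BorelSpace N]
    {φ : M → N} {B s : Set M} {c : ℝ≥0} (hlip : LipschitzOnWith c φ B)
    (hanti : AntilipschitzWith c (B.domRestrict φ)) (hs : s ⊆ B) (d : ℕ) :
    AlmostEq (c ^ d) ((μHE[d] : Measure M) s) ((μHE[d] : Measure N) (φ '' s)) := by
  have himage : B.domRestrict φ '' (Subtype.val ⁻¹' s) = φ '' s := by
    rw [domRestrict_eq, image_comp, Subtype.image_preimage_coe, inter_eq_right.2 hs]
  have hle := hanti.le_hausdorffMeasure_image d.cast_nonneg (Subtype.val ⁻¹' s)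
  rw [himage, ← isometry_subtype_coe.hausdorffMeasure_image (.inl d.cast_nonneg),
    Subtype.image_preimage_coe, inter_eq_right.2 hs] at hle
  have hge := (hlip.mono hs).hausdorffMeasure_image_le d.cast_nonneg
  simp only [ENNReal.rpow_natCast] at hle hge
  simp only [AlmostEq, euclideanHausdorffMeasure_def, Measure.smul_apply, ENNReal.smul_def,
    smul_eq_mul, ENNReal.coe_pow]
  exact ⟨by grw [hle, mul_left_comm], by grw [hge, mul_left_comm]⟩

/-- The map is `x ↦ x + R (ξ x - L x)` with `R` a right inverse of `L`: the error `ξ - L` has a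
small Lipschitz constant near `x₀`. -/
theorem exists_straightening {E F : Type*} [NormedAddCommGroup E] [NormedSpace ℝ E]
    [NormedAddCommGroup F] [NormedSpace ℝ F] [FiniteDimensional ℝ F]
    {ξ : E → F} {L : E →L[ℝ] F} {x₀ : E} (hξ : HasStrictFDerivAt ξ L x₀)
    (hL : Surjective L) {c : ℝ≥0} (hc : 1 < c) :
    ∃ φ : E → E, (∀ x, L (φ x) = ξ x) ∧
      ∃ V ∈ 𝓝 x₀, LipschitzOnWith c φ V ∧ AntilipschitzWith c (V.domRestrict φ) := by
  obtain ⟨R₀, hR₀⟩ := (L : E →ₗ[ℝ] F).exists_rightInverse_of_surjective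
    (LinearMap.range_eq_top.2 hL)
  let R : F →L[ℝ] E := R₀.toContinuousLinearMap
  have hR : ∀ z, L (R z) = z := fun z => LinearMap.congr_fun hR₀ z
  obtain ⟨δ, hδ, hRδ⟩ : ∃ δ : ℝ≥0, 0 < δ ∧ ‖R‖₊ * δ ≤ 1 - c⁻¹ := by
    refine ⟨(1 - c⁻¹) / (‖R‖₊ + 1), by simp [inv_lt_one_of_one_lt₀ hc], ?_⟩
    rw [mul_div_assoc', div_le_iff₀ (by positivity), mul_comm]
    gcongr
    exact le_self_add
  obtain ⟨V, hV, happrox⟩ := hξ.approximates_deriv_on_nhds (Or.inr hδ)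
  have hpert : LipschitzOnWith (1 - c⁻¹) (fun x => R (ξ x - L x)) V :=
    (R.lipschitz.comp_lipschitzOnWith happrox.lipschitzOnWith).weaken hRδ
  exact ⟨fun x => x + R (ξ x - L x), fun x => by simp [hR], V, hV, biLipschitz_id_add hc.le hpert⟩

end BiLipschitz

section Coarea

theorem measurableSet_inter_fiber {α β : Type*} [TopologicalSpace α] [MeasurableSpace α]
    [OpensMeasurableSpace α] [TopologicalSpace β] [T1Space β] {ξ : α → β} {B : Set α}
    (hξ : ContinuousOn ξ B) (hB : MeasurableSet B) (z : β) : MeasurableSet (B ∩ ξ ⁻¹' {z}) := by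
  obtain ⟨K, hK, hKB⟩ := continuousOn_iff_isClosed.1 hξ {z} isClosed_singleton
  rw [inter_comm, hKB]
  exact hK.measurableSet.inter hB

variable {E F : Type*} [NormedAddCommGroup E] [InnerProductSpace ℝ E] [FiniteDimensional ℝ E]
  [MeasurableSpace E] [BorelSpace E] [NormedAddCommGroup F] [InnerProductSpace ℝ F]
  [FiniteDimensional ℝ F]

/-- The measure that the coarea formula puts on the fibre of `ξ : U → F` over `z`: Hausdorff
measure with the reciprocal coarea factor as density. Critical points get weight `0⁻¹ = 0`. -/
noncomputable def fiberMeasure (ξ : E → F) (U : Set E) (z : F) : Measure E :=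
  ((μHE[finrank ℝ E - finrank ℝ F] : Measure E).restrict (U ∩ ξ ⁻¹' {z})).withDensity
    fun x => ENNReal.ofReal (coareaFactor (fderiv ℝ ξ x : E →ₗ[ℝ] F))⁻¹

/-- The regular points of `ξ : U → F`. -/
def regularPoints (ξ : E → F) (U : Set E) : Set E :=
  {x ∈ U | coareaFactor (fderiv ℝ ξ x : E →ₗ[ℝ] F) ≠ 0}

theorem measurable_coareaFactor_fderiv (ξ : E → F) :
    Measurable fun x => coareaFactor (fderiv ℝ ξ x : E →ₗ[ℝ] F) := by
  borelize (E →L[ℝ] F)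
  exact continuous_coareaFactor.measurable.comp (measurable_fderiv ℝ ξ)

theorem measurableSet_regularPoints (ξ : E → F) {U : Set E} (hU : MeasurableSet U) :
    MeasurableSet (regularPoints ξ U) :=
  hU.inter (measurable_coareaFactor_fderiv ξ (measurableSet_singleton 0).compl)

theorem fiberMeasure_apply {ξ : E → F} {U B : Set E} (hB : MeasurableSet B) (hBU : B ⊆ U) (z : F) :
    fiberMeasure ξ U z B = ∫⁻ x in B ∩ ξ ⁻¹' {z},
      ENNReal.ofReal (coareaFactor (fderiv ℝ ξ x : E →ₗ[ℝ] F))⁻¹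
        ∂(μHE[finrank ℝ E - finrank ℝ F] : Measure E) := by
  rw [fiberMeasure, withDensity_apply _ hB, restrict_restrict hB, ← inter_assoc,
    inter_eq_left.2 hBU]

theorem ae_fiberMeasure_mem_fiber {ξ : E → F} {U : Set E} (hU : MeasurableSet U)
    (hξ : ContinuousOn ξ U) (z : F) :
    ∀ᵐ x ∂fiberMeasure ξ U z, x ∈ U ∩ ξ ⁻¹' {z} :=
  (withDensity_absolutelyContinuous _ _).ae_le
    (ae_restrict_mem (measurableSet_inter_fiber hξ hU z))

theorem ae_fiberMeasure_mem_regularPoints {ξ : E → F} {U : Set E} (hU : MeasurableSet U)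
    (hξ : ContinuousOn ξ U) (z : F) : ∀ᵐ x ∂fiberMeasure ξ U z, x ∈ regularPoints ξ U := by
  have hfactor : ∀ᵐ x ∂fiberMeasure ξ U z, coareaFactor (fderiv ℝ ξ x : E →ₗ[ℝ] F) ≠ 0 := by
    refine (ae_withDensity_iff (measurable_coareaFactor_fderiv ξ).inv.ennreal_ofReal).2 ?_
    exact .of_forall fun x hx h => hx (by simp [h])
  filter_upwards [ae_fiberMeasure_mem_fiber hU hξ z, hfactor] with x hx hx' using ⟨hx.1, hx'⟩

theorem fiberMeasure_apply_eq_inter_regularPoints {ξ : E → F} {U : Set E} (hU : MeasurableSet U)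
    (hξ : ContinuousOn ξ U) (z : F) (C : Set E) :
    fiberMeasure ξ U z C = fiberMeasure ξ U z (C ∩ regularPoints ξ U) :=
  measure_congr <| by
    filter_upwards [ae_fiberMeasure_mem_regularPoints hU hξ z] with x hx
    exact propext (and_iff_left hx).symm

variable [MeasurableSpace F] [BorelSpace F]

/-- `B` satisfies the coarea formula for `ξ` up to a factor `c`. The fibre masses are compared with
a measurable `h`, because their own measurability is only obtained in the limit `c → 1`. -/
def AlmostCoarea (ξ : E → F) (U : Set E) (c : ℝ≥0) (B : Set E) : Prop :=
  ∃ h : F → ℝ≥0∞, Measurable h ∧ (∀ z, AlmostEq c (fiberMeasure ξ U z B) (h z)) ∧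
    AlmostEq c (volume B) (∫⁻ z, h z)

theorem AlmostCoarea.mono {ξ : E → F} {U B : Set E} {c c' : ℝ≥0} (h : AlmostCoarea ξ U c B)
    (hc : c ≤ c') : AlmostCoarea ξ U c' B :=
  let ⟨f, hf, hfib, hvol⟩ := h
  ⟨f, hf, fun z => (hfib z).mono hc, hvol.mono hc⟩

theorem AlmostCoarea.empty (ξ : E → F) (U : Set E) (c : ℝ≥0) : AlmostCoarea ξ U c ∅ :=
  ⟨fun _ => 0, measurable_const, by simp [AlmostEq], by simp [AlmostEq]⟩

theorem AlmostCoarea.iUnion {ξ : E → F} {U : Set E} {c : ℝ≥0} {B : ℕ → Set E}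
    (hB : ∀ i, MeasurableSet (B i)) (hd : Pairwise (Disjoint on B))
    (h : ∀ i, AlmostCoarea ξ U c (B i)) : AlmostCoarea ξ U c (⋃ i, B i) := by
  choose f hf hfib hvol using h
  refine ⟨fun z => ∑' i, f i z, .tsum hf, fun z => ?_, ?_⟩
  · rw [measure_iUnion hd hB]
    exact .tsum fun i => hfib i z
  · rw [measure_iUnion hd hB, lintegral_tsum fun i => (hf i).aemeasurable]
    exact .tsum hvol

theorem almostCoarea_of_straightening {ξ : E → F} {U B : Set E} (hξ : ContinuousOn ξ U)
    (hB : MeasurableSet B) (hBU : B ⊆ U) {L : E →ₗ[ℝ] F} (hL : coareaFactor L ≠ 0) {φ : E → E}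
    (hφ : ∀ x ∈ B, L (φ x) = ξ x) {c : ℝ≥0} (hc : 1 ≤ c) (hlip : LipschitzOnWith c φ B)
    (hanti : AntilipschitzWith c (B.domRestrict φ))
    (hfactor : ∀ x ∈ B, AlmostEq c (ENNReal.ofReal (coareaFactor (fderiv ℝ ξ x : E →ₗ[ℝ] F))⁻¹)
      (ENNReal.ofReal (coareaFactor L)⁻¹)) :
    AlmostCoarea ξ U (c ^ (finrank ℝ E + 1)) B := by
  have hsurj := surjective_of_coareaFactor_ne_zero hL
  have hker := finrank_sub_finrank_eq_finrank_ker hsurj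
  have himage : MeasurableSet (φ '' B) :=
    hB.image_of_continuousOn_injOn hlip.continuousOn (injOn_iff_injective.2 hanti.injective)
  have hfib : ∀ z, φ '' B ∩ L ⁻¹' {z} = φ '' (B ∩ ξ ⁻¹' {z}) := fun z => by
    ext y
    constructor
    · rintro ⟨⟨x, hx, rfl⟩, hy⟩
      exact ⟨x, ⟨hx, (hφ x hx).symm.trans hy⟩, rfl⟩
    · rintro ⟨x, ⟨hx, hxz⟩, rfl⟩
      exact ⟨⟨x, hx, rfl⟩, (hφ x hx).trans hxz⟩
  set j := ENNReal.ofReal (coareaFactor L)⁻¹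
  have hj : j * ENNReal.ofReal (coareaFactor L) = 1 := by
    rw [← ENNReal.ofReal_mul (inv_nonneg.2 (coareaFactor_nonneg L)), inv_mul_cancel₀ hL,
      ENNReal.ofReal_one]
  refine ⟨fun z => j * (μHE[finrank ℝ L.ker] : Measure E) (φ '' B ∩ L ⁻¹' {z}),
    (measurable_measure_inter_fiber hsurj himage).const_mul j, fun z => ?_, ?_⟩
  · rw [fiberMeasure_apply hB hBU, hker]
    simp only [hfib]
    have hdensity := AlmostEq.lintegral <| (ae_restrict_iff' (measurableSet_inter_fiber
      (hξ.mono hBU) hB z) (μ := μHE[finrank ℝ L.ker])).2 (.of_forall fun x hx => hfactor x hx.1)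
    rw [setLIntegral_const] at hdensity
    refine (hdensity.trans (.const_mul <| almostEq_euclideanHausdorffMeasure_image hlip hanti
      inter_subset_left _)).mono ?_
    rw [← pow_succ']
    exact pow_le_pow_right₀ hc (by simpa using L.ker.finrank_le)
  · rw [lintegral_const_mul _ (measurable_measure_inter_fiber hsurj himage),
      lintegral_measure_inter_fiber hsurj himage, ← mul_assoc, hj, one_mul]
    simp_rw [← InnerProductSpace.euclideanHausdorffMeasure_eq_volume]
    exact (almostEq_euclideanHausdorffMeasure_image hlip hanti subset_rfl _).mono
      (pow_le_pow_right₀ hc (Nat.le_succ _))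

theorem exists_nhds_almostCoarea {ξ : E → F} {U : Set E} (hU : IsOpen U) (hξ : ContDiffOn ℝ 1 ξ U)
    {x₀ : E} (hx₀ : x₀ ∈ regularPoints ξ U) {c : ℝ≥0} (hc : 1 < c) :
    ∃ W, IsOpen W ∧ x₀ ∈ W ∧ ∀ B ⊆ W, MeasurableSet B → AlmostCoarea ξ U c B := by
  obtain ⟨hxU, hreg⟩ := hx₀
  obtain ⟨c₁, hc₁, hc₁c⟩ : ∃ c₁ : ℝ≥0, 1 < c₁ ∧ c₁ ^ (finrank ℝ E + 1) ≤ c := by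
    have hpow : Tendsto (fun t : ℝ≥0 => t ^ (finrank ℝ E + 1)) (𝓝[>] 1) (𝓝 1) := by
      simpa using ((continuous_pow (finrank ℝ E + 1)).tendsto (1 : ℝ≥0)).mono_left
        nhdsWithin_le_nhds
    obtain ⟨t, htc, ht⟩ := ((hpow.eventually_le_const hc).and self_mem_nhdsWithin).exists
    exact ⟨t, ht, htc⟩
  have hdiff : ContDiffAt ℝ 1 ξ x₀ := hξ.contDiffAt (hU.mem_nhds hxU)
  obtain ⟨φ, hφ, V, hV, hlip, hanti⟩ := exists_straightening
    (hdiff.hasStrictFDerivAt (by norm_num)) (surjective_of_coareaFactor_ne_zero hreg) hc₁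
  set j : E → ℝ≥0∞ := fun x => ENNReal.ofReal (coareaFactor (fderiv ℝ ξ x : E →ₗ[ℝ] F))⁻¹
  have hj : ContinuousAt j x₀ := ENNReal.continuous_ofReal.continuousAt.comp <|
    (continuous_coareaFactor.continuousAt.comp (hdiff.continuousAt_fderiv (by norm_num))).inv₀ hreg
  have hj₀ : 0 < j x₀ := by
    simpa [j] using (coareaFactor_nonneg _).lt_of_ne' hreg
  have hj₀' : j x₀ < c₁ * j x₀ := by
    simpa using ENNReal.mul_lt_mul_left hj₀.ne' ENNReal.ofReal_ne_top (ENNReal.one_lt_coe_iff.2 hc₁)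
  have hlt : ∀ᶠ x in 𝓝 x₀, AlmostEq c₁ (j x) (j x₀) :=
    (hj.eventually_le_const hj₀').and ((ENNReal.Tendsto.const_mul hj
      (Or.inr ENNReal.coe_ne_top)).eventually_const_le hj₀')
  obtain ⟨W, hW, hWo, hxW⟩ := mem_nhds_iff.1 (inter_mem (inter_mem hV (hU.mem_nhds hxU)) hlt)
  refine ⟨W, hWo, hxW, fun B hBW hB => ?_⟩
  have hBV : B ⊆ V := fun x hx => (hW (hBW hx)).1.1
  exact (almostCoarea_of_straightening hξ.continuousOn hB (fun x hx => (hW (hBW hx)).1.2) hreg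
    (fun x _ => hφ x) hc₁.le (hlip.mono hBV)
    (fun x y => hanti ⟨x, hBV x.2⟩ ⟨y, hBV y.2⟩) fun x hx => (hW (hBW hx)).2).mono hc₁c

theorem almostCoarea_of_subset_regularPoints {ξ : E → F} {U : Set E} (hU : IsOpen U)
    (hξ : ContDiffOn ℝ 1 ξ U) {B : Set E} (hB : MeasurableSet B) (hreg : B ⊆ regularPoints ξ U)
    {c : ℝ≥0} (hc : 1 < c) : AlmostCoarea ξ U c B := by
  choose! W hWo hW hWB using fun x (hx : x ∈ B) => exists_nhds_almostCoarea hU hξ (hreg hx) hc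
  obtain ⟨t, htB, ht, hBt⟩ := TopologicalSpace.countable_cover_nhdsWithin
    fun x hx => mem_nhdsWithin_of_mem_nhds ((hWo x hx).mem_nhds (hW x hx))
  rcases t.eq_empty_or_nonempty with rfl | hne
  · rw [subset_empty_iff.1 (by simpa using hBt : B ⊆ ∅)]
    exact .empty ξ U c
  obtain ⟨e, rfl⟩ := ht.exists_eq_range hne
  have heB : ∀ i, e i ∈ B := fun i => htB (mem_range_self i)
  have hcover : B = ⋃ i, B ∩ disjointed (fun i => W (e i)) i := by
    rw [← inter_iUnion, iUnion_disjointed, eq_comm, inter_eq_left]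
    simpa using hBt
  have hmeas : ∀ i, MeasurableSet (B ∩ disjointed (fun i => W (e i)) i) := fun i =>
    hB.inter (.disjointed (fun i => (hWo _ (heB i)).measurableSet) i)
  rw [hcover]
  exact .iUnion hmeas
    (fun i j hij => (disjoint_disjointed _ hij).mono inter_subset_right inter_subset_right)
    fun i => hWB _ (heB i) _ (inter_subset_right.trans (disjointed_subset _ i)) (hmeas i)

theorem coarea_of_subset_regularPoints {ξ : E → F} {U : Set E} (hU : IsOpen U)
    (hξ : ContDiffOn ℝ 1 ξ U) {B : Set E} (hB : MeasurableSet B) (hreg : B ⊆ regularPoints ξ U) :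
    Measurable (fun z => fiberMeasure ξ U z B) ∧ ∫⁻ z, fiberMeasure ξ U z B = volume B := by
  obtain ⟨c, -, hc, hclim⟩ := exists_seq_strictAnti_tendsto (1 : ℝ≥0)
  choose h hh hfib hvol using fun i => almostCoarea_of_subset_regularPoints hU hξ hB hreg (hc i)
  refine ⟨measurable_of_tendsto_metrizable hh
    (tendsto_pi_nhds.2 fun z => AlmostEq.tendsto hclim fun i => hfib i z), ?_⟩
  exact tendsto_nhds_unique
    (AlmostEq.tendsto hclim fun i => .lintegral (.of_forall fun z => hfib i z))
    (AlmostEq.tendsto hclim hvol)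

theorem measurable_fiberMeasure {ξ : E → F} {U : Set E} (hU : IsOpen U)
    (hξ : ContDiffOn ℝ 1 ξ U) : Measurable (fiberMeasure ξ U) := by
  refine measurable_of_measurable_coe _ fun C hC => ?_
  simp_rw [fiberMeasure_apply_eq_inter_regularPoints hU.measurableSet hξ.continuousOn _ C]
  exact (coarea_of_subset_regularPoints hU hξ (hC.inter
    (measurableSet_regularPoints ξ hU.measurableSet)) inter_subset_right).1

theorem coarea_formula {ξ : E → F} {U : Set E} (hU : IsOpen U) (hξ : ContDiffOn ℝ 1 ξ U) :
    (volume : Measure F).bind (fiberMeasure ξ U) = volume.restrict (regularPoints ξ U) := by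
  ext C hC
  rw [bind_apply hC (measurable_fiberMeasure hU hξ).aemeasurable, restrict_apply hC]
  simp_rw [fiberMeasure_apply_eq_inter_regularPoints hU.measurableSet hξ.continuousOn _ C]
  exact (coarea_of_subset_regularPoints hU hξ (hC.inter
    (measurableSet_regularPoints ξ hU.measurableSet)) inter_subset_right).2

end Coarea

section Subtype

variable {α β E : Type*} [MeasurableSpace α] [MeasurableSpace β] [MeasurableSpace E]

theorem comap_coe_preimage_apply {μ : Measure E} {X B : Set E} (hX : NullMeasurableSet X μ)
    (hB : MeasurableSet B) :
    μ.comap (Subtype.val : X → E) (Subtype.val ⁻¹' B) = μ (B ∩ X) := by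
  rw [comap_apply₀ _ _ Subtype.val_injective
    (fun _ h => MeasurableSet.nullMeasurableSet_subtype_coe hX h)
    (measurable_subtype_coe hB).nullMeasurableSet, Subtype.image_preimage_coe, inter_comm]

theorem map_coe_comap_coe {μ : Measure E} {X : Set E} (hX : NullMeasurableSet X μ) :
    (μ.comap (Subtype.val : X → E)).map Subtype.val = μ.restrict X := by
  ext B hB
  rw [map_apply measurable_subtype_coe hB, comap_coe_preimage_apply hX hB, restrict_apply hB]

theorem ae_nullMeasurableSet_of_bind {ζ : Measure α} {κ : α → Measure E} (hκ : AEMeasurable κ ζ)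
    {X : Set E} (hX : NullMeasurableSet X (ζ.bind κ)) : ∀ᵐ z ∂ζ, NullMeasurableSet X (κ z) := by
  obtain ⟨Y, -, hY, hYX⟩ := hX.exists_measurable_subset_ae_eq
  filter_upwards [ae_ae_of_ae_bind hκ hYX] with z hz
  exact hY.nullMeasurableSet.congr hz

/-- A measurable `Y ⊆ X` of full measure gives the measurable representative
`z ↦ ((κ z).restrict Y).comap (↑)`. -/
theorem aemeasurable_comap_coe {ζ : Measure α} {κ : α → Measure E} (hκ : Measurable κ)
    {X : Set E} (hX : NullMeasurableSet X (ζ.bind κ)) :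
    AEMeasurable (fun z => (κ z).comap (Subtype.val : X → E)) ζ := by
  obtain ⟨Y, hYX, hY, hY_ae⟩ := hX.exists_measurable_subset_ae_eq
  have hXY (z : α) : (X : Set E) =ᵐ[(κ z).restrict Y] Y := by
    filter_upwards [ae_restrict_mem hY] with x hx
    exact propext (iff_of_true (hYX hx) hx)
  have hX_restrict (z : α) : NullMeasurableSet X ((κ z).restrict Y) :=
    hY.nullMeasurableSet.congr (hXY z).symm
  refine ⟨fun z => ((κ z).restrict Y).comap Subtype.val, ?_, ?_⟩
  · refine measurable_of_measurable_coe _ ?_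
    rintro _ ⟨B, hB, rfl⟩
    simp_rw [comap_coe_preimage_apply (hX_restrict _) hB, restrict_apply' hY, inter_assoc,
      inter_eq_right.2 hYX]
    exact (measurable_coe (hB.inter hY)).comp hκ
  · filter_upwards [ae_nullMeasurableSet_of_bind hκ.aemeasurable hX,
      ae_ae_of_ae_bind hκ.aemeasurable hY_ae] with z hXz hz
    ext _ ⟨B, hB, rfl⟩
    rw [comap_coe_preimage_apply hXz hB, comap_coe_preimage_apply (hX_restrict z) hB,
      restrict_apply' hY, inter_assoc, inter_eq_right.2 hYX]
    exact measure_congr ((EventuallyEq.refl _ B).inter (EventuallyEq.symm hz))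

theorem bind_comap_coe {ζ : Measure α} {κ : α → Measure E} (hκ : Measurable κ)
    {X : Set E} (hX : NullMeasurableSet X (ζ.bind κ)) :
    ζ.bind (fun z => (κ z).comap (Subtype.val : X → E)) = (ζ.bind κ).comap Subtype.val := by
  obtain ⟨Y, -, hY, hYX⟩ := hX.exists_measurable_subset_ae_eq
  ext _ ⟨B, hB, rfl⟩
  rw [bind_apply (measurable_subtype_coe hB) (aemeasurable_comap_coe hκ hX),
    comap_coe_preimage_apply hX hB, ← measure_congr ((EventuallyEq.refl _ B).inter hYX),
    bind_apply (hB.inter hY) hκ.aemeasurable]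
  refine lintegral_congr_ae ?_
  filter_upwards [ae_nullMeasurableSet_of_bind hκ.aemeasurable hX,
    ae_ae_of_ae_bind hκ.aemeasurable hYX] with z hXz hz
  rw [comap_coe_preimage_apply hXz hB]
  exact measure_congr ((EventuallyEq.refl _ B).inter (EventuallyEq.symm hz))

theorem withDensity_mono_left {μ ν : Measure α} (h : μ ≤ ν) (f : α → ℝ≥0∞) :
    μ.withDensity f ≤ ν.withDensity f :=
  Measure.le_iff.2 fun s hs => by
    simpa only [withDensity_apply f hs] using lintegral_mono' (restrict_mono_measure h s) le_rfl

theorem withDensity_restrict_of_nullMeasurableSet {μ : Measure α} {f : α → ℝ≥0∞} {s : Set α}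
    (hs : NullMeasurableSet s (μ.withDensity f)) :
    (μ.restrict s).withDensity f = (μ.withDensity f).restrict s := by
  obtain ⟨s₁, hs₁s, hs₁, hs₁_ae⟩ := hs.exists_measurable_subset_ae_eq
  obtain ⟨s₂, hss₂, hs₂, hs₂_ae⟩ := hs.exists_measurable_superset_ae_eq
  apply le_antisymm
  · rw [← restrict_congr_set hs₂_ae, restrict_withDensity hs₂]
    exact withDensity_mono_left (restrict_mono_set μ hss₂) f
  · rw [← restrict_congr_set hs₁_ae, restrict_withDensity hs₁]
    exact withDensity_mono_left (restrict_mono_set μ hs₁s) f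

theorem withDensity_euclideanHausdorffMeasure_coe {E : Type*} [EMetricSpace E]
    [MeasurableSpace E] [BorelSpace E] {d : ℕ} {X T : Set E} (hT : MeasurableSet T)
    {f : E → ℝ≥0∞} (hf : Measurable f)
    (hX : NullMeasurableSet X (((μHE[d] : Measure E).restrict T).withDensity f)) :
    ((μHE[d] : Measure X).restrict (Subtype.val ⁻¹' T)).withDensity (fun x => f x) =
      (((μHE[d] : Measure E).restrict T).withDensity f).comap Subtype.val := by
  ext _ ⟨B, hB, rfl⟩
  rw [withDensity_apply _ (measurable_subtype_coe hB),
    ← setLIntegral_map hB hf measurable_subtype_coe, ← restrict_map measurable_subtype_coe hT,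
    isometry_subtype_coe.map_euclideanHausdorffMeasure, Subtype.range_coe,
    restrict_comm hT, ← withDensity_apply _ hB,
    withDensity_restrict_of_nullMeasurableSet hX, restrict_apply hB, comap_coe_preimage_apply hX hB]

theorem aemeasurable_withDensity {ζ : Measure α} {m : α → Measure β} (hm : AEMeasurable m ζ)
    {f : β → ℝ≥0∞} (hf : Measurable f) : AEMeasurable (fun z => (m z).withDensity f) ζ := by
  suffices Measurable fun ν : Measure β => ν.withDensity f from this.comp_aemeasurable hm
  refine measurable_of_measurable_coe _ fun s hs => ?_
  simp_rw [withDensity_apply f hs, ← lintegral_indicator hs]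
  exact measurable_lintegral (hf.indicator hs)

theorem bind_withDensity {ζ : Measure α} {m : α → Measure β} (hm : AEMeasurable m ζ)
    {f : β → ℝ≥0∞} (hf : Measurable f) :
    ζ.bind (fun z => (m z).withDensity f) = (ζ.bind m).withDensity f := by
  ext s hs
  rw [bind_apply hs (aemeasurable_withDensity hm hf), withDensity_apply f hs,
    ← lintegral_indicator hs, lintegral_bind hm (hf.indicator hs).aemeasurable]
  simp_rw [withDensity_apply f hs, lintegral_indicator hs]

end Subtype

section Disintegration

variable {Ω F : Type*} [MeasurableSpace Ω] [MeasurableSpace F]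

/-- A disintegration of the measure `μ` along `ξ : Ω → F`: a measurable family of measures `m z`,
carried by the fibres `ξ ⁻¹' {z}`, whose superposition over `z` (with respect to `ζ`) is `μ`.
The `m z` need not be probability measures, so `ζ` need not be the law of `ξ`. -/
structure IsDisintegration (ζ : Measure F) (μ : Measure Ω) (ξ : Ω → F) (m : F → Measure Ω) :
    Prop where
  measurable : Measurable ξ
  aemeasurable : AEMeasurable m ζ
  bind_eq : ζ.bind m = μ
  ae_fiber : ∀ z, ∀ᵐ x ∂m z, ξ x = z

namespace IsDisintegration

variable {ζ : Measure F} {μ : Measure Ω} {ξ : Ω → F} {m : F → Measure Ω}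

theorem restrict (h : IsDisintegration ζ μ ξ m) {Z : Set F} (hZ : ∀ x, ξ x ∈ Z) :
    IsDisintegration (ζ.restrict Z) μ ξ m where
  measurable := h.measurable
  aemeasurable := h.aemeasurable.restrict
  ae_fiber := h.ae_fiber
  bind_eq := by
    have hm (z : F) (hz : z ∉ Z) : m z = 0 :=
      ae_eq_bot.1 <| eventually_false_iff_eq_bot.1 <|
        (h.ae_fiber z).mono fun x hx => hz (hx ▸ hZ x)
    ext s hs
    rw [← h.bind_eq, bind_apply hs h.aemeasurable.restrict, bind_apply hs h.aemeasurable]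
    exact setLIntegral_eq_of_support_subset fun z hz => by_contra fun hzZ => hz (by simp [hm z hzZ])

theorem quasiMeasurePreserving (h : IsDisintegration ζ μ ξ m) : QuasiMeasurePreserving ξ μ ζ := by
  refine ⟨h.measurable, AbsolutelyContinuous.mk fun s hs hζs => ?_⟩
  rw [map_apply h.measurable hs, ← h.bind_eq, bind_apply (h.measurable hs) h.aemeasurable]
  refine lintegral_eq_zero_of_ae_eq_zero ?_
  filter_upwards [measure_eq_zero_iff_ae_notMem.1 hζs] with z hz
  refine measure_eq_zero_iff_ae_notMem.2 ?_
  filter_upwards [h.ae_fiber z] with x hx hxs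
  exact hz (hx ▸ hxs)

theorem ae_ae (h : IsDisintegration ζ μ ξ m) {p : Ω → Prop} (hp : ∀ᵐ x ∂μ, p x) :
    ∀ᵐ z ∂ζ, ∀ᵐ x ∂m z, p x :=
  ae_ae_of_ae_bind h.aemeasurable (h.bind_eq ▸ hp)

theorem lintegral_lintegral (h : IsDisintegration ζ μ ξ m) {f : Ω → ℝ≥0∞}
    (hf : AEMeasurable f μ) : ∫⁻ z, ∫⁻ x, f x ∂m z ∂ζ = ∫⁻ x, f x ∂μ := by
  rw [← h.bind_eq] at hf ⊢
  exact (lintegral_bind h.aemeasurable hf).symm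

theorem ae_aemeasurable (h : IsDisintegration ζ μ ξ m) {f : Ω → ℝ≥0∞} (hf : AEMeasurable f μ) :
    ∀ᵐ z ∂ζ, AEMeasurable f (m z) :=
  h.aemeasurable.ae_of_bind (h.bind_eq ▸ hf)

theorem ae_lintegral_lt_top (h : IsDisintegration ζ μ ξ m) {f : Ω → ℝ≥0∞} (hf : Measurable f)
    (hf_int : ∫⁻ x, f x ∂μ ≠ ∞) : ∀ᵐ z ∂ζ, ∫⁻ x, f x ∂m z < ∞ :=
  ae_lt_top' ((measurable_lintegral hf).comp_aemeasurable h.aemeasurable)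
    (by rwa [h.lintegral_lintegral hf.aemeasurable])

theorem ae_isFiniteMeasure [IsFiniteMeasure μ] (h : IsDisintegration ζ μ ξ m) :
    ∀ᵐ z ∂ζ, IsFiniteMeasure (m z) := by
  filter_upwards [h.ae_lintegral_lt_top measurable_one (by simp)] with z hz
  exact ⟨by simpa using hz⟩

end IsDisintegration

end Disintegration

section LevelMeasure

variable {n r : ℕ} {X : Set (EuclideanSpace ℝ (Fin n))}
  {ξ : EuclideanSpace ℝ (Fin n) → EuclideanSpace ℝ (Fin r)}

theorem gram_adjoint_fderiv (ξ : EuclideanSpace ℝ (Fin n) → EuclideanSpace ℝ (Fin r))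
    (x : EuclideanSpace ℝ (Fin n)) :
    Matrix.gram ℝ (fun j => LinearMap.adjoint
      (fderiv ℝ ξ x : EuclideanSpace ℝ (Fin n) →ₗ[ℝ] EuclideanSpace ℝ (Fin r))
      (EuclideanSpace.basisFun (Fin r) ℝ j)) = (grad ξ x)ᵀ * grad ξ x := by
  ext i j
  rw [Matrix.gram_apply, ← (EuclideanSpace.basisFun (Fin n) ℝ).sum_inner_mul_inner,
    Matrix.mul_apply]
  refine Finset.sum_congr rfl fun k _ => ?_
  rw [LinearMap.adjoint_inner_left, LinearMap.adjoint_inner_right]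
  simp [grad, EuclideanSpace.inner_single_left, EuclideanSpace.inner_single_right]

theorem gramDet_eq_coareaFactor_sq (x : EuclideanSpace ℝ (Fin n)) :
    gramDet ξ x = coareaFactor (fderiv ℝ ξ x :
      EuclideanSpace ℝ (Fin n) →ₗ[ℝ] EuclideanSpace ℝ (Fin r)) ^ 2 := by
  rw [gramDet, ← gram_adjoint_fderiv]
  exact (LinearMap.normDet_sq_eq_det_gram (𝕜 := ℝ) _ (EuclideanSpace.basisFun (Fin r) ℝ)).symm

theorem sqrt_gramDet (x : EuclideanSpace ℝ (Fin n)) :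
    √(gramDet ξ x) = coareaFactor (fderiv ℝ ξ x :
      EuclideanSpace ℝ (Fin n) →ₗ[ℝ] EuclideanSpace ℝ (Fin r)) := by
  rw [gramDet_eq_coareaFactor_sq, Real.sqrt_sq (coareaFactor_nonneg _)]

theorem sigmaFinite_leb (hX : NullMeasurableSet X volume) : SigmaFinite (leb X) := by
  have h : SigmaFinite ((leb X).map Subtype.val) := by
    rw [leb, map_coe_comap_coe hX]
    infer_instance
  exact SigmaFinite.of_map _ measurable_subtype_coe.aemeasurable h

theorem ae_mem_regularPoints (hX : NullMeasurableSet X volume)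
    (hξ : ∀ᵐ x : X ∂leb X, gramDet ξ x ≠ 0) {U : Set (EuclideanSpace ℝ (Fin n))}
    (hU : MeasurableSet U) (hXU : X ⊆ U) :
    ∀ᵐ x ∂(volume : Measure (EuclideanSpace ℝ (Fin n))), x ∈ X → x ∈ regularPoints ξ U := by
  rw [← ae_restrict_iff'₀ hX, ← map_coe_comap_coe hX]
  refine (ae_map_iff measurable_subtype_coe.aemeasurable (measurableSet_regularPoints ξ hU)).2 ?_
  filter_upwards [hξ] with x hx
  exact ⟨hXU x.2, fun h => hx (by rw [gramDet_eq_coareaFactor_sq, h, zero_pow two_ne_zero])⟩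

theorem comap_restrict_regularPoints (hX : NullMeasurableSet X volume)
    (hξ : ∀ᵐ x : X ∂leb X, gramDet ξ x ≠ 0) {U : Set (EuclideanSpace ℝ (Fin n))}
    (hU : MeasurableSet U) (hXU : X ⊆ U) :
    (volume.restrict (regularPoints ξ U)).comap Subtype.val = leb X := by
  ext _ ⟨B, hB, rfl⟩
  rw [leb, comap_coe_preimage_apply (hX.mono_ac restrict_le_self.absolutelyContinuous) hB,
    comap_coe_preimage_apply hX hB, restrict_apply' (measurableSet_regularPoints ξ hU)]
  refine measure_congr ?_
  filter_upwards [ae_mem_regularPoints hX hξ hU hXU] with x hx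
  exact propext ⟨fun h => h.1, fun h => ⟨h, hx h.2⟩⟩

theorem IsReactionCoordinate.continuous_comp_coe {Z : Set (EuclideanSpace ℝ (Fin r))}
    (hξ : IsReactionCoordinate X Z ξ) : Continuous fun x : X => ξ x := by
  obtain ⟨U, -, hXU, hU⟩ := hξ.contDiffOn
  exact (hU.continuousOn.mono hXU).comp_continuous continuous_subtype_val fun x => x.2

namespace MarkovSystem

variable (S : MarkovSystem X)

theorem levelMeasure_eq_comap_fiberMeasure {U : Set (EuclideanSpace ℝ (Fin n))}
    (hU : IsOpen U) (hXU : X ⊆ U) (hξ : ContinuousOn ξ U) {z : EuclideanSpace ℝ (Fin r)}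
    (hX : NullMeasurableSet X (fiberMeasure ξ U z)) :
    S.levelMeasure ξ z = ((fiberMeasure ξ U z).comap (Subtype.val : X → _)).withDensity
      fun x => ENNReal.ofReal (S.dens x) := by
  have hfiber : MeasurableSet (U ∩ ξ ⁻¹' {z}) := measurableSet_inter_fiber hξ hU.measurableSet z
  have hweight : Measurable fun x => ENNReal.ofReal (coareaFactor (fderiv ℝ ξ x :
      EuclideanSpace ℝ (Fin n) →ₗ[ℝ] EuclideanSpace ℝ (Fin r)))⁻¹ :=
    (measurable_coareaFactor_fderiv ξ).inv.ennreal_ofReal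
  have hweight_coe : Measurable fun x : X => ENNReal.ofReal (coareaFactor (fderiv ℝ ξ x :
      EuclideanSpace ℝ (Fin n) →ₗ[ℝ] EuclideanSpace ℝ (Fin r)))⁻¹ :=
    hweight.comp measurable_subtype_coe
  have hlevel : levelSet X ξ z = Subtype.val ⁻¹' (U ∩ ξ ⁻¹' {z}) := by
    ext x
    exact ⟨fun hx => ⟨hXU x.2, hx⟩, fun hx => hx.2⟩
  rw [fiberMeasure] at hX ⊢
  rw [← withDensity_euclideanHausdorffMeasure_coe hfiber hweight hX,
    ← withDensity_mul _ hweight_coe S.dens_continuous.measurable.ennreal_ofReal,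
    levelMeasure, hlevel]
  simp only [finrank_euclideanSpace_fin]
  congr 1 with x
  rw [sqrt_gramDet, mul_comm, ENNReal.ofReal_mul (inv_nonneg.2 (coareaFactor_nonneg _))]
  rfl

theorem isDisintegration (hX : NullMeasurableSet X volume) {Z : Set (EuclideanSpace ℝ (Fin r))}
    (hξ : IsReactionCoordinate X Z ξ) :
    IsDisintegration (volume.restrict Z) S.mu (fun x : X => ξ x) (S.levelMeasure ξ) := by
  obtain ⟨U, hU, hXU, hξU⟩ := hξ.contDiffOn
  have hκ := measurable_fiberMeasure hU hξU
  have hX' : NullMeasurableSet X ((volume : Measure _).bind (fiberMeasure ξ U)) := by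
    rw [coarea_formula hU hξU]
    exact hX.mono_ac restrict_le_self.absolutelyContinuous
  have hdens := S.dens_continuous.measurable.ennreal_ofReal
  have hlevel := (ae_nullMeasurableSet_of_bind hκ.aemeasurable hX').mono fun z hz =>
    S.levelMeasure_eq_comap_fiberMeasure hU hXU hξU.continuousOn hz
  have hcomap := aemeasurable_comap_coe hκ hX'
  have hvolume : IsDisintegration volume S.mu (fun x : X => ξ x) (S.levelMeasure ξ) :=
    { measurable := hξ.continuous_comp_coe.measurable
      aemeasurable := (aemeasurable_withDensity hcomap hdens).congr (EventuallyEq.symm hlevel)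
      bind_eq := by
        rw [bind_congr_right hlevel, bind_withDensity hcomap hdens, bind_comap_coe hκ hX',
          coarea_formula hU hξU,
          comap_restrict_regularPoints hX hξ.nondegenerate hU.measurableSet hXU]
        rfl
      ae_fiber := fun z => (withDensity_absolutelyContinuous _ _).ae_le
        (ae_restrict_mem (hξ.continuous_comp_coe.measurable (measurableSet_singleton z))) }
  exact hvolume.restrict fun x => hξ.mapsTo x.2

end MarkovSystem

end LevelMeasure

section Averages

variable {Ω Y F G : Type*} [MeasurableSpace Ω] [MeasurableSpace Y] [NormedAddCommGroup G]

theorem lintegral_laverage_le_two_mul {m : Measure Ω} {d : Ω → Ω → ℝ≥0∞} {f : Ω → ℝ≥0∞}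
    (hf : AEMeasurable f m) (h : ∀ᵐ x₂ ∂m, ∀ᵐ x₁ ∂m, d x₁ x₂ ≤ f x₁ + f x₂) :
    ∫⁻ x₂, ⨍⁻ x₁, d x₁ x₂ ∂m ∂m ≤ 2 * ∫⁻ x, f x ∂m := by
  have havg : ∀ᵐ x₂ ∂m, ⨍⁻ x₁, d x₁ x₂ ∂m ≤ (⨍⁻ x, f x ∂m) + f x₂ := by
    filter_upwards [h] with x₂ hx₂
    calc ⨍⁻ x₁, d x₁ x₂ ∂m ≤ ⨍⁻ x₁, (f x₁ + f x₂) ∂m := laverage_mono_ae hx₂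
      _ = (⨍⁻ x, f x ∂m) + f x₂ * (m univ / m univ) := by
        rw [laverage_eq, laverage_eq, lintegral_add_left' hf, lintegral_const, ENNReal.add_div,
          mul_div_assoc]
      _ ≤ (⨍⁻ x, f x ∂m) + f x₂ := by
        gcongr
        exact mul_le_of_le_one_right' ENNReal.div_self_le_one
  calc ∫⁻ x₂, ⨍⁻ x₁, d x₁ x₂ ∂m ∂m
      ≤ ∫⁻ x₂, ((⨍⁻ x, f x ∂m) + f x₂) ∂m := lintegral_mono_ae havg
    _ = m univ * ((∫⁻ x, f x ∂m) / m univ) + ∫⁻ x, f x ∂m := by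
      rw [lintegral_add_left measurable_const, lintegral_const, laverage_eq, mul_comm]
    _ ≤ 2 * ∫⁻ x, f x ∂m := by
      rw [two_mul]
      gcongr
      exact ENNReal.mul_div_le

variable [NormedSpace ℝ G]

theorem eLpNorm_sub_integral_le [CompleteSpace G] {ρ : Measure Ω} [IsProbabilityMeasure ρ]
    {lam : Measure Y} [SFinite lam] {p : Ω → Y → G}
    (hp : Integrable (fun w : Ω × Y => p w.1 w.2) (ρ.prod lam)) {f : Y → G}
    (hf : AEStronglyMeasurable f lam) :
    eLpNorm (fun y => f y - ∫ x, p x y ∂ρ) 1 lam ≤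
      ∫⁻ x, eLpNorm (fun y => f y - p x y) 1 lam ∂ρ := by
  simp_rw [eLpNorm_one_eq_lintegral_enorm]
  have hmeas : AEMeasurable (fun w : Ω × Y => ‖f w.2 - p w.1 w.2‖ₑ) (ρ.prod lam) :=
    (hf.comp_snd.sub hp.aestronglyMeasurable).enorm
  rw [lintegral_lintegral_swap hmeas]
  refine lintegral_mono_ae ?_
  filter_upwards [hp.prod_left_ae] with y hy
  have hcenter : f y - ∫ x, p x y ∂ρ = ∫ x, (f y - p x y) ∂ρ := by
    rw [integral_sub (integrable_const _) hy, integral_const, probReal_univ, one_smul]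
  rw [hcenter]
  exact enorm_integral_le_lintegral_enorm _

theorem eLpNorm_sub_average_le [CompleteSpace G] {ν : Measure Ω} [IsFiniteMeasure ν] [NeZero ν]
    {lam : Measure Y} [SFinite lam] {p : Ω → Y → G}
    (hp : Integrable (fun w : Ω × Y => p w.1 w.2) (ν.prod lam)) {f : Y → G}
    (hf : AEStronglyMeasurable f lam) :
    eLpNorm (fun y => f y - ⨍ x, p x y ∂ν) 1 lam ≤
      ⨍⁻ x, eLpNorm (fun y => f y - p x y) 1 lam ∂ν := by
  refine eLpNorm_sub_integral_le ?_ hf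
  rw [prod_smul_left]
  exact hp.smul_measure (ENNReal.inv_ne_top.2 (NeZero.ne (ν univ)))

variable [MeasurableSpace F]

theorem measurable_inv_smul_self {m : F → Measure Ω} (hm : Measurable m) :
    Measurable fun z => (m z univ)⁻¹ • m z := by
  refine measurable_of_measurable_coe _ fun s hs => ?_
  simp only [Measure.smul_apply, smul_eq_mul]
  exact ((measurable_coe .univ).comp hm).inv.mul ((measurable_coe hs).comp hm)

theorem stronglyMeasurable_average {m : F → Measure Ω} (hm : Measurable m) {p : Ω → Y → G}
    (hp : StronglyMeasurable fun w : Ω × Y => p w.1 w.2) :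
    StronglyMeasurable fun w : F × Y => ⨍ x, p x w.2 ∂m w.1 := by
  let ρ : Kernel (F × Y) Ω :=
    ⟨fun w => (m w.1 univ)⁻¹ • m w.1, measurable_inv_smul_self (hm.comp measurable_fst)⟩
  have hρ : IsFiniteKernel ρ := ⟨1, ENNReal.one_lt_top, fun w => ENNReal.inv_mul_le_one _⟩
  have hp_swap : StronglyMeasurable fun v : (F × Y) × Ω => p v.2 v.1.2 :=
    hp.comp_measurable (measurable_snd.prodMk (measurable_snd.comp measurable_fst))
  exact hp_swap.integral_kernel_prod_right' (κ := ρ)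

theorem IsDisintegration.aestronglyMeasurable_average {ζ : Measure F} {μ : Measure Ω}
    {ξ : Ω → F} {m : F → Measure Ω} (h : IsDisintegration ζ μ ξ m) {lam : Measure Y}
    {p : Ω → Y → G} (hp : StronglyMeasurable fun w : Ω × Y => p w.1 w.2) :
    AEStronglyMeasurable (fun w : Ω × Y => ⨍ x, p x w.2 ∂m (ξ w.1)) (μ.prod lam) := by
  refine ⟨fun w => ⨍ x, p x w.2 ∂h.aemeasurable.mk m (ξ w.1),
    stronglyMeasurable_average (h.aemeasurable.measurable_mk.comp h.measurable) hp, ?_⟩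
  filter_upwards [(h.quasiMeasurePreserving.comp quasiMeasurePreserving_fst).ae
    h.aemeasurable.ae_eq_mk] with w hw
  simp only [comp_apply] at hw
  rw [hw]

end Averages

section Lumpability

variable {Ω Y F G : Type*} [MeasurableSpace Ω] [MeasurableSpace Y] [NormedAddCommGroup G]

/-- The left-hand side of (L), before division by `|Z|`: the `L¹(μ ⊗ λ)`-distance of the density
`p` to the effective density `q ∘ ξ`. -/
noncomputable def lumpingError (μ : Measure Ω) (lam : Measure Y) (ξ : Ω → F) (p : Ω → Y → G)
    (q : F → Y → G) : ℝ≥0∞ :=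
  eLpNorm (fun w : Ω × Y => p w.1 w.2 - q (ξ w.1) w.2) 1 (μ.prod lam)

variable {μ : Measure Ω} {lam : Measure Y} [SFinite lam] {ξ : Ω → F}

theorem lumpingError_eq_lintegral {p : Ω → Y → G} {q : F → Y → G}
    (hpq : AEStronglyMeasurable (fun w : Ω × Y => p w.1 w.2 - q (ξ w.1) w.2) (μ.prod lam)) :
    lumpingError μ lam ξ p q = ∫⁻ x, eLpNorm (fun y => p x y - q (ξ x) y) 1 lam ∂μ := by
  simp_rw [lumpingError, eLpNorm_one_eq_lintegral_enorm]
  exact lintegral_prod _ hpq.enorm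

theorem aemeasurable_eLpNorm_one {g : Ω → Y → G}
    (hg : AEStronglyMeasurable (fun w : Ω × Y => g w.1 w.2) (μ.prod lam)) :
    AEMeasurable (fun x => eLpNorm (g x) 1 lam) μ := by
  simp_rw [eLpNorm_one_eq_lintegral_enorm]
  exact hg.enorm.lintegral_prod_right'

variable [MeasurableSpace F] {ζ : Measure F} {m : F → Measure Ω}

/-- The left-hand side of (L'), before division by `|Z|`, with the inner integral over the fibre
replaced by an average: the total `L¹(λ)`-oscillation of `x ↦ p x` along the fibres of a
disintegration `m`. -/
noncomputable def fiberVariation (ζ : Measure F) (m : F → Measure Ω) (lam : Measure Y)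
    (p : Ω → Y → G) : ℝ≥0∞ :=
  ∫⁻ z, ∫⁻ x₂, ⨍⁻ x₁, eLpNorm (fun y => p x₁ y - p x₂ y) 1 lam ∂m z ∂m z ∂ζ

namespace IsDisintegration

theorem fiberVariation_le_two_mul_lumpingError (h : IsDisintegration ζ μ ξ m) {p : Ω → Y → G}
    {q : F → Y → G}
    (hpq : AEStronglyMeasurable (fun w : Ω × Y => p w.1 w.2 - q (ξ w.1) w.2) (μ.prod lam)) :
    fiberVariation ζ m lam p ≤ 2 * lumpingError μ lam ξ p q := by
  set f : Ω → ℝ≥0∞ := fun x => eLpNorm (fun y => p x y - q (ξ x) y) 1 lam with hf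
  have hf_meas : AEMeasurable f μ := aemeasurable_eLpNorm_one hpq
  have hfiber : ∀ᵐ z ∂ζ, ∫⁻ x₂, ⨍⁻ x₁, eLpNorm (fun y => p x₁ y - p x₂ y) 1 lam ∂m z ∂m z ≤
      2 * ∫⁻ x, f x ∂m z := by
    filter_upwards [h.ae_ae hpq.prodMk_left, h.ae_aemeasurable hf_meas] with z hz hfz
    refine lintegral_laverage_le_two_mul hfz ?_
    filter_upwards [hz, h.ae_fiber z] with x₂ hx₂ hxz₂
    filter_upwards [hz, h.ae_fiber z] with x₁ hx₁ hxz₁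
    have htriangle := eLpNorm_sub_le hx₁ hx₂ le_rfl
    simpa only [Pi.sub_def, hf, hxz₁, hxz₂, sub_sub_sub_cancel_right] using htriangle
  calc fiberVariation ζ m lam p ≤ ∫⁻ z, 2 * ∫⁻ x, f x ∂m z ∂ζ := lintegral_mono_ae hfiber
    _ = 2 * lumpingError μ lam ξ p q := by
      rw [lintegral_const_mul' _ _ ENNReal.ofNat_ne_top, h.lintegral_lintegral hf_meas,
        lumpingError_eq_lintegral hpq]

theorem ae_integrable_prod [IsFiniteMeasure μ] (h : IsDisintegration ζ μ ξ m) {p : Ω → Y → G}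
    (hp : StronglyMeasurable fun w : Ω × Y => p w.1 w.2)
    (hp_int : Integrable (fun w : Ω × Y => p w.1 w.2) (μ.prod lam)) :
    ∀ᵐ z ∂ζ, Integrable (fun w : Ω × Y => p w.1 w.2) ((m z).prod lam) := by
  have hlint : ∫⁻ x, ∫⁻ y, ‖p x y‖ₑ ∂lam ∂μ ≠ ∞ := by
    rw [← lintegral_prod _ hp.enorm.aemeasurable]
    exact hp_int.hasFiniteIntegral.ne
  filter_upwards [h.ae_isFiniteMeasure, h.ae_lintegral_lt_top hp.enorm.lintegral_prod_right' hlint]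
    with z _ hz
  refine ⟨hp.aestronglyMeasurable, ?_⟩
  rwa [HasFiniteIntegral, lintegral_prod _ hp.enorm.aemeasurable]

theorem lumpingError_average_le_fiberVariation [NormedSpace ℝ G] [CompleteSpace G]
    [IsFiniteMeasure μ] (h : IsDisintegration ζ μ ξ m) {p : Ω → Y → G}
    (hp : StronglyMeasurable fun w : Ω × Y => p w.1 w.2)
    (hp_int : Integrable (fun w : Ω × Y => p w.1 w.2) (μ.prod lam)) :
    lumpingError μ lam ξ p (fun z y => ⨍ x, p x y ∂m z) ≤ fiberVariation ζ m lam p := by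
  have hpq := hp.aestronglyMeasurable.sub (h.aestronglyMeasurable_average (lam := lam) hp)
  rw [lumpingError_eq_lintegral hpq, ← h.lintegral_lintegral (aemeasurable_eLpNorm_one hpq)]
  refine lintegral_mono_ae ?_
  filter_upwards [h.ae_isFiniteMeasure, h.ae_integrable_prod hp hp_int] with z hfin hz
  rcases eq_zero_or_neZero (m z) with hmz | hmz
  · simp [hmz]
  refine lintegral_mono_ae ?_
  filter_upwards [h.ae_fiber z] with x₂ hx₂
  have hpx₂ : AEStronglyMeasurable (p x₂) lam :=
    (hp.comp_measurable measurable_prodMk_left).aestronglyMeasurable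
  calc eLpNorm (fun y => p x₂ y - ⨍ x, p x y ∂m (ξ x₂)) 1 lam
      ≤ ⨍⁻ x₁, eLpNorm (fun y => p x₂ y - p x₁ y) 1 lam ∂m z := by
        rw [hx₂]
        exact eLpNorm_sub_average_le hz hpx₂
    _ = ⨍⁻ x₁, eLpNorm (fun y => p x₁ y - p x₂ y) 1 lam ∂m z := by
        simp_rw [← Pi.sub_def, eLpNorm_sub_comm (p x₂)]

end IsDisintegration

end Lumpability

section TransitionDensity

theorem enorm_eq_ofReal_add_ofReal_neg (a : ℝ) :
    ‖a‖ₑ = ENNReal.ofReal a + ENNReal.ofReal (-a) := by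
  rw [Real.enorm_eq_ofReal_abs]
  rcases le_total 0 a with ha | ha
  · simp [abs_of_nonneg ha, ENNReal.ofReal_of_nonpos, ha]
  · simp [abs_of_nonpos ha, ENNReal.ofReal_of_nonpos ha]

theorem enorm_sub_eq_tsub_add_tsub {a b : ℝ} (ha : 0 ≤ a) (hb : 0 ≤ b) :
    ‖a - b‖ₑ = ENNReal.ofReal a - ENNReal.ofReal b + (ENNReal.ofReal b - ENNReal.ofReal a) := by
  rw [enorm_eq_ofReal_add_ofReal_neg, neg_sub, ENNReal.ofReal_sub _ hb, ENNReal.ofReal_sub _ ha]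

variable {Ω Y : Type*} [MeasurableSpace Ω] [MeasurableSpace Y]

theorem lintegral_mul_tsub_lintegral_mul_le {lam : Measure Ω} {f g k : Ω → ℝ≥0∞}
    (hg : Measurable g) (hk : Measurable k) :
    ∫⁻ x, f x * k x ∂lam - ∫⁻ x, g x * k x ∂lam ≤ ∫⁻ x, (f x - g x) * k x ∂lam := by
  rw [tsub_le_iff_right]
  calc ∫⁻ x, f x * k x ∂lam ≤ ∫⁻ x, ((f x - g x) * k x + g x * k x) ∂lam := by
        simp_rw [← add_mul]
        gcongr
        exact le_tsub_add
    _ = ∫⁻ x, (f x - g x) * k x ∂lam + ∫⁻ x, g x * k x ∂lam := lintegral_add_right _ (hg.mul hk)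

theorem eLpNorm_sub_le_of_eq_lintegral_mul {lam : Measure Ω} {lam' : Measure Y} [SFinite lam]
    [SFinite lam'] {k : Ω → Y → ℝ≥0∞} (hk : Measurable fun w : Ω × Y => k w.1 w.2)
    (hk_le : ∀ x, ∫⁻ y, k x y ∂lam' ≤ 1) {f g : Ω → ℝ} (hf : Measurable f) (hg : Measurable g)
    (hf_nonneg : 0 ≤ f) (hg_nonneg : 0 ≤ g) {f' g' : Y → ℝ} (hf'_nonneg : 0 ≤ f')
    (hg'_nonneg : 0 ≤ g')
    (hff' : ∀ᵐ y ∂lam', ENNReal.ofReal (f' y) = ∫⁻ x, ENNReal.ofReal (f x) * k x y ∂lam)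
    (hgg' : ∀ᵐ y ∂lam', ENNReal.ofReal (g' y) = ∫⁻ x, ENNReal.ofReal (g x) * k x y ∂lam) :
    eLpNorm (fun y => f' y - g' y) 1 lam' ≤ eLpNorm (fun x => f x - g x) 1 lam := by
  simp_rw [eLpNorm_one_eq_lintegral_enorm]
  have hbound : ∀ᵐ y ∂lam', ‖f' y - g' y‖ₑ ≤ ∫⁻ x, ‖f x - g x‖ₑ * k x y ∂lam := by
    filter_upwards [hff', hgg'] with y hfy hgy
    have hky : Measurable fun x => k x y := hk.comp measurable_prodMk_right
    simp_rw [enorm_sub_eq_tsub_add_tsub (hf'_nonneg y) (hg'_nonneg y), hfy, hgy,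
      fun x => enorm_sub_eq_tsub_add_tsub (hf_nonneg x) (hg_nonneg x), add_mul]
    exact (add_le_add (lintegral_mul_tsub_lintegral_mul_le hg.ennreal_ofReal hky)
      (lintegral_mul_tsub_lintegral_mul_le hf.ennreal_ofReal hky)).trans (le_lintegral_add _ _)
  have hmeas : Measurable fun w : Y × Ω => ‖f w.2 - g w.2‖ₑ * k w.2 w.1 :=
    ((hf.sub hg).enorm.comp measurable_snd).mul (hk.comp measurable_swap)
  calc ∫⁻ y, ‖f' y - g' y‖ₑ ∂lam'
      ≤ ∫⁻ y, ∫⁻ x, ‖f x - g x‖ₑ * k x y ∂lam ∂lam' := lintegral_mono_ae hbound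
    _ = ∫⁻ x, ‖f x - g x‖ₑ * ∫⁻ y, k x y ∂lam' ∂lam := by
      rw [lintegral_lintegral_swap hmeas.aemeasurable]
      exact lintegral_congr fun x => lintegral_const_mul _ (hk.comp measurable_prodMk_left)
    _ ≤ ∫⁻ x, ‖f x - g x‖ₑ ∂lam := lintegral_mono fun x => mul_le_of_le_one_right' (hk_le x)

/-- The transition densities `p t x y`, `t > 0`, with respect to `lam` of a possibly killed
(sub-Markov) process in continuous time. The Chapman–Kolmogorov equation is required for almost
every `y` only, since densities are determined up to null sets. -/
structure IsTransitionDensity (p : ℝ → Ω → Ω → ℝ) (lam : Measure Ω) : Prop where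
  measurable : ∀ t, 0 < t → Measurable fun w : Ω × Ω => p t w.1 w.2
  nonneg : ∀ t, 0 < t → ∀ x y, 0 ≤ p t x y
  lintegral_le_one : ∀ t, 0 < t → ∀ x, ∫⁻ y, ENNReal.ofReal (p t x y) ∂lam ≤ 1
  chapman_kolmogorov : ∀ s t, 0 < s → 0 < t → ∀ x, ∀ᵐ y ∂lam,
    ENNReal.ofReal (p (s + t) x y) =
      ∫⁻ w, ENNReal.ofReal (p s x w) * ENNReal.ofReal (p t w y) ∂lam

namespace IsTransitionDensity

variable {p : ℝ → Ω → Ω → ℝ} {lam : Measure Ω} [SFinite lam]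

theorem integrable (hp : IsTransitionDensity p lam) {t : ℝ} (ht : 0 < t) (μ : Measure Ω)
    [IsFiniteMeasure μ] : Integrable (fun w : Ω × Ω => p t w.1 w.2) (μ.prod lam) := by
  have hmeas := hp.measurable t ht
  refine ⟨hmeas.aestronglyMeasurable, ?_⟩
  rw [HasFiniteIntegral, lintegral_prod _ hmeas.enorm.aemeasurable]
  calc ∫⁻ x, ∫⁻ y, ‖p t x y‖ₑ ∂lam ∂μ
      = ∫⁻ x, ∫⁻ y, ENNReal.ofReal (p t x y) ∂lam ∂μ := by
        simp_rw [fun x y => Real.enorm_of_nonneg (hp.nonneg t ht x y)]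
    _ ≤ ∫⁻ _, 1 ∂μ := lintegral_mono (hp.lintegral_le_one t ht)
    _ < ∞ := by simp

theorem eLpNorm_sub_le (hp : IsTransitionDensity p lam) {s t : ℝ} (hs : 0 < s) (hst : s ≤ t)
    (x₁ x₂ : Ω) :
    eLpNorm (fun y => p t x₁ y - p t x₂ y) 1 lam ≤
      eLpNorm (fun y => p s x₁ y - p s x₂ y) 1 lam := by
  rcases hst.eq_or_lt with rfl | hst
  · exact le_rfl
  obtain ⟨u, hu, rfl⟩ : ∃ u, 0 < u ∧ t = s + u := ⟨t - s, sub_pos.2 hst, (add_sub_cancel s t).symm⟩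
  have hsu : 0 < s + u := add_pos hs hu
  exact eLpNorm_sub_le_of_eq_lintegral_mul (hp.measurable u hu).ennreal_ofReal
    (hp.lintegral_le_one u hu) ((hp.measurable s hs).comp measurable_prodMk_left)
    ((hp.measurable s hs).comp measurable_prodMk_left) (hp.nonneg s hs x₁) (hp.nonneg s hs x₂)
    (hp.nonneg _ hsu x₁) (hp.nonneg _ hsu x₂) (hp.chapman_kolmogorov s u hs hu x₁)
    (hp.chapman_kolmogorov s u hs hu x₂)

theorem fiberVariation_anti (hp : IsTransitionDensity p lam) {F : Type*} [MeasurableSpace F]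
    (ζ : Measure F) (m : F → Measure Ω) {s t : ℝ} (hs : 0 < s) (hst : s ≤ t) :
    fiberVariation ζ m lam (p t) ≤ fiberVariation ζ m lam (p s) :=
  lintegral_mono fun _ => lintegral_mono fun x₂ => lintegral_mono fun x₁ =>
    hp.eLpNorm_sub_le hs hst x₁ x₂

end IsTransitionDensity

end TransitionDensity

section Markov

variable {n : ℕ} {X : Set (EuclideanSpace ℝ (Fin n))} {t : ℝ}

namespace MarkovSystem

theorem lintegral_density (S : MarkovSystem X) (ht : 0 < t) (x : X) :
    ∫⁻ y, ENNReal.ofReal (S.p t x y) ∂leb X = 1 := by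
  have hmarkov := S.markov t ht
  have hmass : S.P t x univ = 1 := measure_univ
  rwa [S.p_density t ht, withDensity_apply _ .univ, Measure.restrict_univ] at hmass

theorem ae_chapman_kolmogorov (S : MarkovSystem X) (hX : NullMeasurableSet X volume) {s : ℝ}
    (hs : 0 < s) (ht : 0 < t) (x : X) :
    ∀ᵐ y ∂leb X, ENNReal.ofReal (S.p (s + t) x y) =
      ∫⁻ w, ENNReal.ofReal (S.p s x w) * ENNReal.ofReal (S.p t w y) ∂leb X := by
  have hσ := sigmaFinite_leb hX
  have hp {t : ℝ} (ht : 0 < t) (x : X) : Measurable fun y => ENNReal.ofReal (S.p t x y) :=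
    ((S.p_measurable t ht).comp measurable_prodMk_left).ennreal_ofReal
  have hprod : Measurable fun v : X × X =>
      ENNReal.ofReal (S.p s x v.2) * ENNReal.ofReal (S.p t v.2 v.1) :=
    ((hp hs x).comp measurable_snd).mul
      ((S.p_measurable t ht).ennreal_ofReal.comp measurable_swap)
  refine (withDensity_eq_iff_of_sigmaFinite (hp (add_pos hs ht) x).aemeasurable
    hprod.lintegral_prod_right'.aemeasurable).1 ?_
  rw [← S.p_density _ (add_pos hs ht), S.chapman_kolmogorov s t hs ht]
  ext A hA
  calc (S.P t ∘ₖ S.P s) x A = ∫⁻ w, ENNReal.ofReal (S.p s x w) * S.P t w A ∂leb X := by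
        rw [Kernel.comp_apply' _ _ _ hA, S.p_density s hs,
          lintegral_withDensity_eq_lintegral_mul _ (hp hs x) ((S.P t).measurable_coe hA)]
        rfl
    _ = ∫⁻ w, ∫⁻ y in A, ENNReal.ofReal (S.p s x w) * ENNReal.ofReal (S.p t w y) ∂leb X
          ∂leb X := by
        refine lintegral_congr fun w => ?_
        rw [lintegral_const_mul _ (hp ht w), S.p_density t ht, withDensity_apply _ hA]
    _ = _ := by
        rw [withDensity_apply _ hA, ← lintegral_lintegral_swap hprod.aemeasurable]

theorem isTransitionDensity (S : MarkovSystem X) (hX : NullMeasurableSet X volume) :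
    IsTransitionDensity S.p (leb X) where
  measurable := S.p_measurable
  nonneg := S.p_nonneg
  lintegral_le_one _ ht x := (S.lintegral_density ht x).le
  chapman_kolmogorov _ _ hs ht x := S.ae_chapman_kolmogorov hX hs ht x

end MarkovSystem

end Markov

end ReactionCoordinate

open ReactionCoordinate in
theorem mainTheorem6_general {Ω F : Type*} [MeasurableSpace Ω] [MeasurableSpace F]
    {ζ : Measure F} {μ : Measure Ω} [IsFiniteMeasure μ] {lam : Measure Ω} [SFinite lam]
    {ξ : Ω → F} {m : F → Measure Ω} (h : IsDisintegration ζ μ ξ m) {p : ℝ → Ω → Ω → ℝ}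
    (hp : IsTransitionDensity p lam) {τ : ℝ} (hτ : 0 < τ) :
    (∀ q : F → Ω → ℝ, AEStronglyMeasurable (fun w : Ω × Ω => q (ξ w.1) w.2) (μ.prod lam) →
      fiberVariation ζ m lam (p τ) ≤ 2 * lumpingError μ lam ξ (p τ) q) ∧
    ∀ t, τ ≤ t →
      AEStronglyMeasurable (fun w : Ω × Ω => ⨍ x, p t x w.2 ∂m (ξ w.1)) (μ.prod lam) ∧
      lumpingError μ lam ξ (p t) (fun z y => ⨍ x, p t x y ∂m z) ≤ fiberVariation ζ m lam (p τ) := by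
  refine ⟨fun q hq => h.fiberVariation_le_two_mul_lumpingError
    ((hp.measurable τ hτ).aestronglyMeasurable.sub hq), fun t ht => ?_⟩
  have hmeas := (hp.measurable t (hτ.trans_le ht)).stronglyMeasurable
  exact ⟨h.aestronglyMeasurable_average hmeas,
    (h.lumpingError_average_le_fiberVariation hmeas (hp.integrable (hτ.trans_le ht) μ)).trans
      (hp.fiberVariation_anti ζ m hτ ht)⟩

namespace ReactionCoordinate.MarkovSystem

variable {n r : ℕ} {X : Set (EuclideanSpace ℝ (Fin n))} {S : MarkovSystem X}
  {Z : Set (EuclideanSpace ℝ (Fin r))} {ξ : EuclideanSpace ℝ (Fin n) → EuclideanSpace ℝ (Fin r)}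
  {t τ ε : ℝ}

theorem IsLumpableAt.isDifferentiallyLumpableAvg (hX : NullMeasurableSet X volume)
    (hξ : IsReactionCoordinate X Z ξ) (hτ : 0 < τ) (h : S.IsLumpableAt Z ξ τ ε) :
    S.IsDifferentiallyLumpableAvg Z ξ τ (2 * ε) := by
  obtain ⟨q, -, hq, hqε⟩ := h
  have hσ := sigmaFinite_leb hX
  have hprob : IsProbabilityMeasure S.mu := S.prob
  have hvar :=
    (mainTheorem6_general (S.isDisintegration hX hξ) (S.isTransitionDensity hX) hτ).1 q hq
  calc (volume Z)⁻¹ * fiberVariation (volume.restrict Z) (S.levelMeasure ξ) (leb X) (S.p τ)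
      ≤ (volume Z)⁻¹ * (2 * lumpingError S.mu (leb X) (fun x : X => ξ x) (S.p τ) q) := by gcongr
    _ = 2 * ((volume Z)⁻¹ * lumpingError S.mu (leb X) (fun x : X => ξ x) (S.p τ) q) := by ring
    _ ≤ 2 * ENNReal.ofReal ε := by gcongr; exact hqε
    _ = ENNReal.ofReal (2 * ε) := by rw [ENNReal.ofReal_mul zero_le_two, ENNReal.ofReal_ofNat]

theorem IsDifferentiallyLumpableAvg.isLumpableThrough (hX : NullMeasurableSet X volume)
    (hξ : IsReactionCoordinate X Z ξ) (hτ : 0 < τ) (h : S.IsDifferentiallyLumpableAvg Z ξ τ ε) :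
    S.IsLumpableThrough Z ξ τ ε fun t z y => ⨍ x, S.p t x y ∂S.levelMeasure ξ z := by
  intro t ht
  have hσ := sigmaFinite_leb hX
  have hprob : IsProbabilityMeasure S.mu := S.prob
  obtain ⟨hmeas, herror⟩ :=
    (mainTheorem6_general (S.isDisintegration hX hξ) (S.isTransitionDensity hX) hτ).2 t ht
  exact ⟨fun z _ y => integral_nonneg fun x => S.p_nonneg t (hτ.trans_le ht) x y, hmeas,
    (mul_le_mul_right herror _).trans h⟩

theorem isDifferentiallyLumpable_iff_avg
    (h : ∀ᵐ z ∂volume.restrict Z, IsProbabilityMeasure (S.levelMeasure ξ z)) :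
    S.IsDifferentiallyLumpable Z ξ τ ε ↔ S.IsDifferentiallyLumpableAvg Z ξ τ ε := by
  rw [IsDifferentiallyLumpable, IsDifferentiallyLumpableAvg]
  refine iff_of_eq (congrArg (fun c => (volume Z)⁻¹ * c ≤ ENNReal.ofReal ε) ?_)
  refine lintegral_congr_ae (h.mono fun z hz => ?_)
  simp only [laverage_eq_lintegral]

theorem IsLumpableWith.congr {q q' : EuclideanSpace ℝ (Fin r) → X → ℝ}
    (h : S.IsLumpableWith Z ξ t ε q) (hq' : ∀ z ∈ Z, ∀ y, 0 ≤ q' z y)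
    (hqq' : ∀ᵐ x : X ∂S.mu, q (ξ x) = q' (ξ x)) : S.IsLumpableWith Z ξ t ε q' := by
  have hae : ∀ᵐ w ∂S.mu.prod (leb X), q (ξ w.1) w.2 = q' (ξ w.1) w.2 :=
    (Measure.quasiMeasurePreserving_fst.ae hqq').mono fun w hw => congrFun hw w.2
  refine ⟨hq', h.2.1.congr hae, ?_⟩
  rw [← eLpNorm_congr_ae (hae.mono fun w hw => congrArg (S.p t w.1 w.2 - ·) hw)]
  exact h.2.2

theorem IsDifferentiallyLumpable.isLumpableThrough (hX : NullMeasurableSet X volume)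
    (hξ : IsReactionCoordinate X Z ξ)
    (hprob : ∀ᵐ z ∂volume.restrict Z, IsProbabilityMeasure (S.levelMeasure ξ z)) (hτ : 0 < τ)
    (h : S.IsDifferentiallyLumpable Z ξ τ ε) :
    S.IsLumpableThrough Z ξ τ ε fun t z y => ∫ x, S.p t x y ∂S.levelMeasure ξ z := by
  intro t ht
  have havg := ((isDifferentiallyLumpable_iff_avg hprob).1 h).isLumpableThrough hX hξ hτ t ht
  refine havg.congr
    (fun z _ y => integral_nonneg fun x => S.p_nonneg t (hτ.trans_le ht) x y) ?_
  filter_upwards [(S.isDisintegration hX hξ).quasiMeasurePreserving.ae hprob] with x hx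
  simp only [average_eq_integral]

end ReactionCoordinate.MarkovSystem

theorem mainTheorem6 {n r : ℕ} (hr : r ≤ n)
    {X : Set (EuclideanSpace ℝ (Fin n))} (hX : NullMeasurableSet X volume)
    (S : ReactionCoordinate.MarkovSystem X)
    {Z : Set (EuclideanSpace ℝ (Fin r))} (hZ : MeasurableSet Z)
    {ξ : EuclideanSpace ℝ (Fin n) → EuclideanSpace ℝ (Fin r)}
    (hξ : ReactionCoordinate.IsReactionCoordinate X Z ξ)
    {τ : ℝ} (hτ : 0 < τ) {ε : ℝ} (hε : 0 ≤ ε) :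
    -- the marginal stationary measures are probability measures
    ((∀ᵐ z ∂(volume.restrict Z), IsProbabilityMeasure (S.levelMeasure ξ z)) →
      (S.IsLumpableAt Z ξ τ ε → S.IsDifferentiallyLumpable Z ξ τ (2 * ε)) ∧
      (S.IsDifferentiallyLumpable Z ξ τ ε →
        S.IsLumpableThrough Z ξ τ ε
          fun t z y => ∫ x', S.p t x' y ∂(S.levelMeasure ξ z))) ∧
    -- marginal stationary measures of arbitrary total mass
    (S.IsLumpableAt Z ξ τ ε → S.IsDifferentiallyLumpableAvg Z ξ τ (2 * ε)) ∧
    (S.IsDifferentiallyLumpableAvg Z ξ τ ε →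
      S.IsLumpableThrough Z ξ τ ε
        fun t z y => ⨍ x', S.p t x' y ∂(S.levelMeasure ξ z)) := by
  have forward (h : S.IsLumpableAt Z ξ τ ε) := h.isDifferentiallyLumpableAvg hX hξ hτ
  have backward (h : S.IsDifferentiallyLumpableAvg Z ξ τ ε) := h.isLumpableThrough hX hξ hτ
  refine ⟨fun hprob => ⟨fun h => ?_, fun h => h.isLumpableThrough hX hξ hprob hτ⟩, forward,
    backward⟩
  exact (ReactionCoordinate.MarkovSystem.isDifferentiallyLumpable_iff_avg hprob).2 (forward h)
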